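/- **Setting.** Let $d\ge 1$, $\mathcal X=[0,1]^d$ with the Euclidean norm. A simulation at $x\in\mathcal X$ returns a random output $Y(x)$ with mean $\mu(x)=\mathbb E[Y(x)]$; different simulations are independent. Assume: 1. (sub-Gaussian noise) for some constant $C_{\rm sg}$, the noise $\epsilon(x)=Y(x)-\mu(x)$ satisfies $\mathbb E[e^{\lambda\epsilon(x)}]\le e^{\lambda^2C_{\rm sg}^2/2}$ for all $x\in\mathcal X$, $\lambda\in\mathbb R$; 2. $\mu$ has a unique maximizer $x^*\in\mathcal X$, and for some $C>0$, $\mu(x^*)-\mu(x)\le C\|x-x^*\|$ for all $x\in\mathcal X$; 3. for every $\varepsilon>0$ there is $\delta(\varepsilon)>0$ with $\mu(x)<\mu(x^*)-\delta(\varepsilon)$ for all $x\in\mathcal X$ with $\|x-x^*\|\ge\varepsilon$. **Regular Tree Search.** The parameters are $\alpha\in(0,\frac12]$, $\kappa\in(0,1]$, $\beta\in(0,\frac12)$, a nondecreasing $f:\mathbb N\to\{1,2,\dots\}$, a total budget $N$ and a Stage 1 budget $N_0<N$ (which may depend on $N$). The algorithm keeps a binary tree whose leaves are hyperrectangles partitioning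 $\mathcal X$, and two disjoint data sets $\mathcal S_{\mathcal I}$ and $\mathcal S_{\mathcal J}$ of pairs $(x_i,Y_i)$. The depth of a node is the number of cuts leading to it. *Splitting a leaf $L=\prod_j[r_j^-,r_j^+]$ of depth $c$.* A cut of $L$ at the value $z$ of the coordinate $j$ gives $L\cap\{x^{(j)}\le z\}$ and $L\cap\{x^{(j)}>z\}$; it is admissible if $(1-\alpha)r_j^-+\alpha r_j^+\le z\le\alpha r_j^-+(1-\alpha)r_j^+$ and both parts contain at least $\beta f(c)$ points of $\mathcal S_{\mathcal I}$. With probability $\kappa$ (independently of everything else) choose $j$ uniformly at random and take a $z$ that minimizes, among the admissible cuts along $j$, the sum over the two parts of the squared deviations of the $\mathcal S_{\mathcal J}$-responses from their average in that part; otherwise minimize over all admissible $(j,z)$. Ties are resolved by any fixed measurable rule that uses only $f(c)$, the rectangle, the positions of the $\mathcal S_{\mathcal I}$-points of $L$ and the $\mathcal S_{\mathcal J}$-data of $L$. *Stage 1.* Simulate once at each of $N_0$ independent uniform points of $\mathcal X$; $\lfloor N_0/2\rfloor$ of the samples form $\mathcal S_{\mathcal I}$, the others $\mathcal S_{\mathcal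 J}$. Starting from $\mathcal X$, split every node of depth $c$ that contains at least $f(c)$ points of $\mathcal S_{\mathcal I}$. *Stage 2.* While fewer than $N$ simulations have been made: a tree search strategy (an arbitrary rule, which may be randomized and may depend on $N$) selects a leaf $\hat L$, of depth $c$ say; simulate at a uniform point of $\hat L$ and add the sample to $\mathcal S_{\mathcal I}$; if $\hat L$ now contains exactly $f(c)$ points of $\mathcal S_{\mathcal I}$, simulate at uniform points of $\hat L$, adding the samples to $\mathcal S_{\mathcal J}$, until $\hat L$ contains at least $f(c)$ points of $\mathcal S_{\mathcal J}$, and split $\hat L$. *Output.* A leaf $L_N^*$ with the largest sample mean of its $\mathcal S_{\mathcal I}$-responses. Let $V_N$ be the event that the run with budget $N$ can be carried out, i.e. that every split it prescribes has an admissible cut; assume $\mathbb P(V_N)>0$ for all large $N$. **Theorem 1.** Let $h^-,h^+:\mathbb N\to\mathbb N$ be such that for every $N$, almost surely on $V_N$, the depth of each leaf of the final tree lies between $h^-(N)$ and $h^+(N)$. If $$\lim_{N\to\infty}h^-(N)=\infty\qquad\text{and}\qquad\lim_{N\to\infty}\frac{h^+(N)}{f(h^-(N))}=0,$$ then $\mathrm{dist}(L_N^*,x^*)=\inf_{x\in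 L_N^*}\|x-x^*\|$ converges to $0$ in probability on the executable runs: for every $\varepsilon>0$, $$\lim_{N\to\infty}\mathbb P\big(V_N\cap\{\mathrm{dist}(L_N^*,x^*)\ge\varepsilon\}\big)=0 .$$ -/

import Mathlib

open MeasureTheory ProbabilityTheory Filter Topology
open scoped NNReal ENNReal

noncomputable section

namespace RegularTreeSearch

/-- Points of `ℝ^d` with the Euclidean norm. -/
abbrev Pt (d : ℕ) := EuclideanSpace ℝ (Fin d)

/-- The feasible domain `[0,1]^d`. -/
def cube (d : ℕ) : Set (Pt d) := {x | ∀ i, x i ∈ Set.Icc (0 : ℝ) 1}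

/-- The response surface `μ(x) = E[Y | X = x]` of a simulation model: `sim x v` is the output of a
simulation at the design point `x` driven by the random seed `v`, whose law is `Q`. -/
def response {d : ℕ} {V : Type*} [MeasurableSpace V] (Q : Measure V) (sim : Pt d → V → ℝ)
    (x : Pt d) : ℝ := ∫ v, sim x v ∂Q

/-! ### Cells -/

/-- A cell of the partition: a hyperrectangle with lower corner `lo` and upper corner `hi`.
The set `region` keeps track of which faces belong to the cell, so that the cells of a tree
partition the cube. -/
structure Cell (d : ℕ) where
  lo : Fin d → ℝ
  hi : Fin d → ℝ
  region : Set (Pt d)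

/-- The root cell `[0,1]^d`. -/
def Cell.root (d : ℕ) : Cell d := ⟨fun _ => 0, fun _ => 1, cube d⟩

/-- The children of a cell that is cut at the value `z` of the coordinate `j`:
`L₁ = L ∩ {x_j ≤ z}` (flag `false`) and `L₂ = L ∩ {x_j > z}` (flag `true`). -/
def Cell.child {d : ℕ} (B : Cell d) (j : Fin d) (z : ℝ) : Bool → Cell d
  | false => ⟨B.lo, Function.update B.hi j z, B.region ∩ {x | x j ≤ z}⟩
  | true => ⟨Function.update B.lo j z, B.hi, B.region ∩ {x | z < x j}⟩

/-- The point of the cell with relative coordinates `u ∈ [0,1]^d`. If `u` is uniform on the unit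
cube, then this point is uniform on the cell. -/
def Cell.place {d : ℕ} (B : Cell d) (u : Fin d → ℝ) : Pt d :=
  WithLp.toLp 2 (fun i => B.lo i + u i * (B.hi i - B.lo i))

/-! ### The splitting criterion -/

/-- The data on which the split of a node may depend (honesty): the threshold `f(c)` at its depth
`c`, the rectangle, the positions (not the responses) of its `𝓘`-samples, and its `𝓙`-samples. -/
structure SplitData (d : ℕ) where
  thr : ℕ
  lo : Fin d → ℝ
  hi : Fin d → ℝ
  ptsI : List (Pt d)
  smpJ : List (Pt d × ℝ)

/-- The cut at the value `z` of the coordinate `j` satisfies the constraints: each child keeps at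
least a fraction `α` of the side that is cut, and at least `β f(c)` of the `𝓘`-samples. -/
def SplitData.Feasible {d : ℕ} (D : SplitData d) (α β : ℝ) (j : Fin d) (z : ℝ) : Prop :=
  (1 - α) * D.lo j + α * D.hi j ≤ z ∧ z ≤ α * D.lo j + (1 - α) * D.hi j ∧
  β * D.thr ≤ (D.ptsI.countP (fun x => decide (x j ≤ z)) : ℝ) ∧
  β * D.thr ≤ (D.ptsI.countP (fun x => decide (z < x j)) : ℝ)

/-- Average of a list of responses. -/
def avg (l : List ℝ) : ℝ := l.sum / l.length

/-- Sum of the squared deviations from the average. -/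
def sqDev (l : List ℝ) : ℝ := (l.map (fun y => (y - avg l) ^ 2)).sum

/-- The squared-error criterion of a cut, computed on the `𝓙`-samples. -/
def SplitData.loss {d : ℕ} (D : SplitData d) (j : Fin d) (z : ℝ) : ℝ :=
  sqDev ((D.smpJ.filter (fun p => decide (p.1 j ≤ z))).map Prod.snd) +
  sqDev ((D.smpJ.filter (fun p => decide (z < p.1 j))).map Prod.snd)

/-- A way of choosing a minimizer of the squared-error criterion: `along D j` is the cut value when
the coordinate `j` is prescribed, `free D` the coordinate and the cut value when both are chosen. -/
structure Selector (d : ℕ) where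
  along : SplitData d → Fin d → ℝ
  free : SplitData d → Fin d × ℝ

/-- The selector returns a minimizer over the feasible cuts whenever there is a feasible cut. -/
def Selector.Optimal {d : ℕ} (s : Selector d) (α β : ℝ) : Prop :=
  (∀ (D : SplitData d) (j : Fin d), (∃ z, D.Feasible α β j z) →
    D.Feasible α β j (s.along D j) ∧
      ∀ z, D.Feasible α β j z → D.loss j (s.along D j) ≤ D.loss j z) ∧
  (∀ D : SplitData d, (∃ j z, D.Feasible α β j z) →
    D.Feasible α β (s.free D).1 (s.free D).2 ∧
      ∀ j z, D.Feasible α β j z → D.loss (s.free D).1 (s.free D).2 ≤ D.loss j z)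

/-- Split data with `n` `𝓘`-samples and `m` `𝓙`-samples, from tuples. -/
def SplitData.ofTuples {d : ℕ} (thr n m : ℕ)
    (p : ((Fin d → ℝ) × (Fin d → ℝ)) × (Fin n → Pt d) × (Fin m → Pt d × ℝ)) : SplitData d :=
  ⟨thr, p.1.1, p.1.2, List.ofFn p.2.1, List.ofFn p.2.2⟩

/-- The choice depends measurably on the data, for every fixed number of samples. -/
def Selector.IsMeasurable {d : ℕ} (s : Selector d) : Prop :=
  ∀ thr n m : ℕ,
    (∀ j, Measurable fun p => s.along (SplitData.ofTuples thr n m p) j) ∧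
    Measurable fun p => s.free (SplitData.ofTuples thr n m p)

/-! ### Nodes and runs -/

/-- The data of the problem and of the algorithm that a run uses. -/
structure Model (d : ℕ) (V : Type*) where
  /-- spatial balance -/
  α : ℝ
  /-- sample balance -/
  β : ℝ
  /-- sample threshold, as a function of the depth -/
  f : ℕ → ℕ
  /-- simulation output at a design point for a random seed -/
  sim : Pt d → V → ℝ
  sel : Selector d

/-- A node of the tree. `addr` is the list of left/right turns from the root, the last turn first;
`smpI`, `smpJ` are the samples `(x_i, Y_i)` of `𝓢_𝓘`, `𝓢_𝓙` in its cell; `visits` counts the points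
that were sampled for `𝓢_𝓘` while the node was a leaf; `valid` says that every cut made on the way
from the root satisfied the constraints. -/
structure Node (d : ℕ) where
  addr : List Bool
  cell : Cell d
  smpI : List (Pt d × ℝ)
  smpJ : List (Pt d × ℝ)
  visits : ℕ
  valid : Prop

/-- The depth of a node is the number of cuts that led to it. -/
def Node.depth {d : ℕ} (L : Node d) : ℕ := L.addr.length

/-- The sample mean `Ȳ_L`, computed from `𝓢_𝓘`. -/
def Node.mean {d : ℕ} (L : Node d) : ℝ := avg (L.smpI.map Prod.snd)

/-- Names of the independent random inputs of simulations. Each of them is used at most once in a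
run: `first i` is for the `i`-th point of Stage 1, `est a k` for the `k`-th point sampled for `𝓢_𝓘`
in Stage 2 while the node `a` is a leaf, `grow a k` for the `k`-th point sampled for `𝓢_𝓙` just
before the node `a` is split. -/
inductive Input where
  | first (i : ℕ)
  | est (a : List Bool) (k : ℕ)
  | grow (a : List Bool) (k : ℕ)

/-- Sample a point uniformly from a cell and simulate there; the input consists of the relative
coordinates of the point and of the seed of the simulation. -/
def Model.sample {d : ℕ} {V : Type*} (M : Model d V) (B : Cell d) (w : (Fin d → ℝ) × V) :
    Pt d × ℝ := (B.place w.1, M.sim (B.place w.1) w.2)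

/-- What the splitting criterion may use at a node. -/
def Model.splitData {d : ℕ} {V : Type*} (M : Model d V) (L : Node d) : SplitData d :=
  ⟨M.f L.depth, L.cell.lo, L.cell.hi, L.smpI.map Prod.fst, L.smpJ⟩

/-- The splitting criterion. `e a = (b, j)` is the random choice at the node `a`: if `b` is `true`
(probability `κ`), the cut is along the random coordinate `j`; otherwise the coordinate is
optimized too. -/
def Model.cut {d : ℕ} {V : Type*} (M : Model d V) (e : List Bool → Bool × Fin d) (L : Node d) :
    Fin d × ℝ :=
  if (e L.addr).1 = true then
    ((e L.addr).2, M.sel.along (M.splitData L) (e L.addr).2)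
  else M.sel.free (M.splitData L)

/-- The two children of a node; the samples are distributed to them according to the cut. -/
def Model.child {d : ℕ} {V : Type*} (M : Model d V) (e : List Bool → Bool × Fin d) (L : Node d)
    (b : Bool) : Node d :=
  let c := M.cut e L
  let keep : Pt d × ℝ → Bool := fun p => if b then decide (c.2 < p.1 c.1) else decide (p.1 c.1 ≤ c.2)
  { addr := b :: L.addr
    cell := L.cell.child c.1 c.2 b
    smpI := L.smpI.filter keep
    smpJ := L.smpJ.filter keep
    visits := 0
    valid := L.valid ∧ (M.splitData L).Feasible M.α M.β c.1 c.2 }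

/-- Growing a regular tree from given data: a node of depth `c` is split as long as it contains at
least `f(c)` samples of `𝓢_𝓘`. A feasible cut leaves fewer samples in each child, so that the number
of these samples bounds the number of levels (first argument) that are needed. -/
def Model.growTree {d : ℕ} {V : Type*} (M : Model d V) (e : List Bool → Bool × Fin d) :
    ℕ → Node d → List (Node d)
  | 0, L => [L]
  | k + 1, L =>
    if M.f L.depth ≤ L.smpI.length then
      M.growTree e k (M.child e L false) ++ M.growTree e k (M.child e L true)
    else [L]

/-- The current leaves and the number of simulations made so far. -/
structure State (d : ℕ) where
  leaves : List (Node d)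
  n : ℕ

/-- Every cut made so far satisfied the constraints, i.e. the run could be carried out. -/
def State.Valid {d : ℕ} (S : State d) : Prop := ∀ L ∈ S.leaves, L.valid

/-- The root node with the `N₀` samples of Stage 1, of which the first `⌊N₀ / 2⌋` go to `𝓢_𝓘`
and the others to `𝓢_𝓙`. -/
def Model.rootNode {d : ℕ} {V : Type*} (M : Model d V) (w : Input → (Fin d → ℝ) × V) (N₀ : ℕ) :
    Node d :=
  let S := (List.range N₀).map fun i => M.sample (Cell.root d) (w (.first i))
  { addr := []
    cell := Cell.root d
    smpI := S.take (N₀ / 2)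
    smpJ := S.drop (N₀ / 2)
    visits := 0
    valid := True }

/-- Stage 1. -/
def Model.stageOne {d : ℕ} {V : Type*} (M : Model d V) (w : Input → (Fin d → ℝ) × V)
    (e : List Bool → Bool × Fin d) (N₀ : ℕ) : State d :=
  { leaves := M.growTree e (M.rootNode w N₀).smpI.length (M.rootNode w N₀)
    n := N₀ }

/-- A tree search strategy selects one of the current leaves. -/
structure Strategy (d : ℕ) where
  pick : State d → Node d
  pick_mem : ∀ S : State d, S.leaves ≠ [] → pick S ∈ S.leaves

/-- The node after one more sample for `𝓢_𝓘`. -/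
def Model.visit {d : ℕ} {V : Type*} (M : Model d V) (w : Input → (Fin d → ℝ) × V) (L : Node d) :
    Node d :=
  { L with
    smpI := L.smpI ++ [M.sample L.cell (w (.est L.addr L.visits))]
    visits := L.visits + 1 }

/-- The number of samples to be added to `𝓢_𝓙` before a split (truncated subtraction:
`max {f(c) - #, 0}`). -/
def Model.missing {d : ℕ} {V : Type*} (M : Model d V) (L : Node d) : ℕ :=
  M.f L.depth - L.smpJ.length

/-- The node after the samples for `𝓢_𝓙` have been added. -/
def Model.topUp {d : ℕ} {V : Type*} (M : Model d V) (w : Input → (Fin d → ℝ) × V) (L : Node d) :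
    Node d :=
  { L with
    smpJ := L.smpJ ++ (List.range (M.missing L)).map fun k => M.sample L.cell (w (.grow L.addr k)) }

/-- One iteration of Stage 2. -/
def Model.step {d : ℕ} {V : Type*} (M : Model d V) (w : Input → (Fin d → ℝ) × V)
    (e : List Bool → Bool × Fin d) (σ : Strategy d) (S : State d) : State d :=
  let L := M.visit w (σ.pick S)
  let others := S.leaves.filter fun L' => decide (L'.addr ≠ L.addr)
  if L.smpI.length = M.f L.depth then
    { leaves := M.child e (M.topUp w L) false :: M.child e (M.topUp w L) true :: others
      n := S.n + M.missing L + 1 }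
  else
    { leaves := L :: others
      n := S.n + 1 }

/-- The state at the end of Regular Tree Search with total budget `N` and Stage 1 budget `N₀`: Stage 1
followed by iterations of Stage 2 as long as fewer than `N` simulations have been made (at most `N`
iterations, since each makes at least one simulation). -/
def Model.run {d : ℕ} {V : Type*} (M : Model d V) (w : Input → (Fin d → ℝ) × V)
    (e : List Bool → Bool × Fin d) (σ : Strategy d) (N₀ N : ℕ) : State d :=
  (fun S => if S.n < N then M.step w e σ S else S)^[N] (M.stageOne w e N₀)

/-- `L` is a leaf with the largest sample mean. -/
def State.IsBest {d : ℕ} (S : State d) (L : Node d) : Prop :=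
  L ∈ S.leaves ∧ ∀ L' ∈ S.leaves, L'.mean ≤ L.mean

/-- The random inputs: all of them are independent; relative coordinates are uniform on the unit cube
and independent of the seed, which has law `Q`; the choice at a node is `true` with probability `κ`,
and independently of this its coordinate is uniform on the `d` coordinates. -/
structure IsRandomSource {d : ℕ} {V Ω : Type*} [MeasurableSpace V] [MeasurableSpace Ω]
    (P : Measure Ω) (Q : Measure V) (κ : ℝ) (draw : Input → Ω → (Fin d → ℝ) × V)
    (coin : List Bool → Ω → Bool × Fin d) : Prop where
  draw_measurable : ∀ i, Measurable (draw i)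
  coin_measurable : ∀ a, Measurable (coin a)
  draw_law : ∀ i, P.map (draw i) =
    ((volume : Measure (Fin d → ℝ)).restrict (Set.Icc 0 1)).prod Q
  coin_law : ∀ a b j, P {ω | coin a ω = (b, j)} =
    ENNReal.ofReal ((if b = true then κ else 1 - κ) / d)
  draw_indep : iIndepFun draw P
  coin_indep : iIndepFun coin P
  draw_coin_indep : IndepFun (fun ω i => draw i ω) (fun ω a => coin a ω) P

end RegularTreeSearch

end

/-! The tree that a strategy explores can be laid out in advance. A node is split as soon as its
`𝓘`-count has reached the threshold, so the node with address `a` at its creation, `born a`, is a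
function of the random inputs alone; the strategy only decides which nodes are reached and how often
a leaf is visited. A leaf of an executable run is therefore `born a` after `k` visits
(`step_reached`). Bounds that hold for all `a` of the relevant depths and for all `k` at once hold
for every strategy, even one that anticipates the future.

Let `m` be the response. If every leaf has an average noise below `δ/4` and `m` varies by at most
`δ/4` below its maximum on the leaf of `x*`, then a leaf at distance `≥ ε` from `x*` loses against
the leaf of `x*` (`infDist_lt_of_not_bad`). Two bad events remain.

Noise. Cells, positions and names of the `𝓘`-samples do not depend on the seeds of the `𝓘`-samples
(`born_congr_seed`). Once everything else is frozen, the noise in a node is a sum of independent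
sub-Gaussian terms, and Hoeffding applies (`measure_noiseBad_le`). A valid leaf of depth `c` has at
least `β f(c-1) + k` samples, so the union over `k` costs a constant and the union over addresses
costs `∑ 2^c exp(-θ β f(c-1))` over the levels from `h⁻` to `h⁺`.

Size. A coin-forced cut along `j` shrinks side `j` by the factor `1 - α`, and the number of such
cuts on the branch to `x*` is handled by an exponential moment, because each coin is fresh given the
branch above it (`lintegral_cutCount_pathTo`).

The levels above `h⁻` in the sum are negligible by the ratio hypothesis, but the level `h⁻` itself
involves `f(h⁻-1)`, which that hypothesis does not mention. `eventually_depth_le_threshold` recovers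
it by applying the hypothesis at a smaller budget, just too small for a tree of minimal depth
`h⁻(N)`: if `f(h⁻(N)-1)` were of order at most `h⁻(N)`, that tree would be too shallow to use up its
budget. -/

noncomputable section

namespace RegularTreeSearch

/-! ### The strategy-independent tree and the effect of visits and splits -/

section Dynamics

variable {d : ℕ} {V : Type*} (M : Model d V) (w : Input → (Fin d → ℝ) × V)
  (e : List Bool → Bool × Fin d) (N₀ : ℕ)

/-- The node at the moment of its split: if it has too few samples, then it is visited until it has
`f(c)` samples of `𝓢_𝓘`, and topped up. -/
def Model.full (L : Node d) : Node d :=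
  if M.f L.depth ≤ L.smpI.length then L
  else M.topUp w ((M.visit w)^[M.f L.depth - L.smpI.length] L)

/-- The node with a given address at the moment of its creation. It does not depend on the
strategy. -/
def Model.born : List Bool → Node d
  | [] => M.rootNode w N₀
  | b :: a => M.child e (M.full w (Model.born a)) b

@[simp] lemma Model.visit_iterate_addr (k : ℕ) (L : Node d) :
    ((M.visit w)^[k] L).addr = L.addr := by
  induction k with
  | zero => rfl
  | succ k ih => rw [Function.iterate_succ_apply']; exact ih

@[simp] lemma Model.visit_iterate_depth (k : ℕ) (L : Node d) :
    ((M.visit w)^[k] L).depth = L.depth := by simp [Node.depth]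

@[simp] lemma Model.visit_iterate_cell (k : ℕ) (L : Node d) :
    ((M.visit w)^[k] L).cell = L.cell := by
  induction k with
  | zero => rfl
  | succ k ih => rw [Function.iterate_succ_apply']; exact ih

@[simp] lemma Model.visit_iterate_smpJ (k : ℕ) (L : Node d) :
    ((M.visit w)^[k] L).smpJ = L.smpJ := by
  induction k with
  | zero => rfl
  | succ k ih => rw [Function.iterate_succ_apply']; exact ih

@[simp] lemma Model.visit_iterate_valid (k : ℕ) (L : Node d) :
    ((M.visit w)^[k] L).valid = L.valid := by
  induction k with
  | zero => rfl
  | succ k ih => rw [Function.iterate_succ_apply']; exact ih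

@[simp] lemma Model.visit_iterate_visits (k : ℕ) (L : Node d) :
    ((M.visit w)^[k] L).visits = L.visits + k := by
  induction k with
  | zero => rfl
  | succ k ih => rw [Function.iterate_succ_apply']; simp [Model.visit, ih, add_assoc]

lemma Model.visit_iterate_smpI (k : ℕ) (L : Node d) :
    ((M.visit w)^[k] L).smpI = L.smpI ++
      (List.range k).map fun i => M.sample L.cell (w (.est L.addr (L.visits + i))) := by
  induction k with
  | zero => simp
  | succ k ih =>
    rw [Function.iterate_succ_apply']
    simp [Model.visit, ih, List.range_succ]

@[simp] lemma Model.full_addr (L : Node d) : (M.full w L).addr = L.addr := by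
  unfold Model.full; split_ifs <;> simp [Model.topUp]

@[simp] lemma Model.full_depth (L : Node d) : (M.full w L).depth = L.depth := by
  simp [Node.depth]

@[simp] lemma Model.full_cell (L : Node d) : (M.full w L).cell = L.cell := by
  unfold Model.full; split_ifs <;> simp [Model.topUp]

@[simp] lemma Model.full_valid (L : Node d) : (M.full w L).valid = L.valid := by
  unfold Model.full; split_ifs <;> simp [Model.topUp]

lemma Model.full_smpI (L : Node d) : (M.full w L).smpI = L.smpI ++
    (List.range (M.f L.depth - L.smpI.length)).map
      fun i => M.sample L.cell (w (.est L.addr (L.visits + i))) := by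
  unfold Model.full
  split_ifs with h
  · simp [Nat.sub_eq_zero_of_le h]
  · simp [Model.topUp, Model.visit_iterate_smpI]

lemma Model.full_smpJ (L : Node d) : (M.full w L).smpJ = L.smpJ ++
    (List.range (if M.f L.depth ≤ L.smpI.length then 0 else M.f L.depth - L.smpJ.length)).map
      fun k => M.sample L.cell (w (.grow L.addr k)) := by
  unfold Model.full
  split_ifs with h
  · simp
  · simp [Model.topUp, Model.missing]

@[simp] lemma Model.child_addr (L : Node d) (b : Bool) : (M.child e L b).addr = b :: L.addr := rfl

@[simp] lemma Model.child_depth (L : Node d) (b : Bool) : (M.child e L b).depth = L.depth + 1 := by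
  simp [Node.depth]

@[simp] lemma Model.born_addr (a : List Bool) : (M.born w e N₀ a).addr = a := by
  induction a with
  | nil => rfl
  | cons b a ih => simp [Model.born, ih]

@[simp] lemma Model.born_depth (a : List Bool) : (M.born w e N₀ a).depth = a.length := by
  simp [Node.depth]

@[simp] lemma Model.born_visits (a : List Bool) : (M.born w e N₀ a).visits = 0 := by
  cases a <;> rfl

lemma Model.length_child_smpI_add (L : Node d) :
    (M.child e L false).smpI.length + (M.child e L true).smpI.length = L.smpI.length := by
  simp only [Model.child, Bool.false_eq_true, if_false, if_true]
  rw [← List.countP_eq_length_filter, ← List.countP_eq_length_filter,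
    List.length_eq_countP_add_countP (fun p : Pt d × ℝ => decide (p.1 (M.cut e L).1 ≤ (M.cut e L).2))]
  congr 2
  funext p
  simp

lemma Model.le_length_child_smpI {L : Node d} {b : Bool} (h : (M.child e L b).valid) :
    M.β * M.f L.depth ≤ (M.child e L b).smpI.length := by
  obtain ⟨-, -, -, h1, h2⟩ := h
  simp only [Model.splitData, List.countP_map, Function.comp_def] at h1 h2
  cases b
  · simpa only [Model.child, Bool.false_eq_true, if_false, ← List.countP_eq_length_filter] using h1
  · simpa only [Model.child, if_true, ← List.countP_eq_length_filter] using h2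

lemma Model.child_valid_congr {L : Node d} {b b' : Bool} (h : (M.child e L b).valid) :
    (M.child e L b').valid := h

/-- The sibling keeps at least `β f(c) > 0` samples. This makes the sample count sufficient fuel for
`growTree`, and keeps a fresh child of a Stage 2 split below its own threshold. -/
lemma Model.length_child_smpI_lt (hβ : 0 < M.β) (hf : ∀ c, 0 < M.f c) {L : Node d} {b : Bool}
    (h : (M.child e L b).valid) : (M.child e L b).smpI.length < L.smpI.length := by
  have h1 := M.le_length_child_smpI e (M.child_valid_congr e (b' := !b) h)
  have h2 := M.length_child_smpI_add e L
  have h3 : 0 < M.β * M.f L.depth := mul_pos hβ (by exact_mod_cast hf _)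
  have h4 : 0 < (M.child e L (!b)).smpI.length := by exact_mod_cast h3.trans_le h1
  cases b <;> simp at h4 ⊢ <;> omega

end Dynamics

/-! ### Invariants of the run: partition, counting, identification of the leaves -/

section Invariants

variable {d : ℕ} {V : Type*} (M : Model d V) (w : Input → (Fin d → ℝ) × V)
  (e : List Bool → Bool × Fin d) (N₀ : ℕ)

/-- Neither of two nodes is an ancestor of the other. -/
def Node.Incomparable (L L' : Node d) : Prop := ¬ L.addr <:+ L'.addr ∧ ¬ L'.addr <:+ L.addr

lemma suffix_cons_ne {a l : List Bool} {b b' : Bool} (h : b :: a <:+ l) (h' : b' :: a <:+ l) :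
    b = b' := by
  have := (List.suffix_of_suffix_length_le h h' (by simp)).eq_of_length (by simp)
  simpa using this

lemma Node.incomparable_of_suffix {L L' : Node d} {a : List Bool} {b b' : Bool} (hb : b ≠ b')
    (h : b :: a <:+ L.addr) (h' : b' :: a <:+ L'.addr) : L.Incomparable L' :=
  ⟨fun hs => hb (suffix_cons_ne (h.trans hs) h'), fun hs => hb (suffix_cons_ne h (h'.trans hs))⟩

lemma Model.exists_child_mem {L : Node d} {x : Pt d} (hx : x ∈ L.cell.region) :
    ∃ b, x ∈ (M.child e L b).cell.region := by
  rcases le_or_gt (x (M.cut e L).1) (M.cut e L).2 with h | h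
  · exact ⟨false, hx, h⟩
  · exact ⟨true, hx, h⟩

lemma Model.growTree_suffix (k : ℕ) (L : Node d) : ∀ L' ∈ M.growTree e k L, L.addr <:+ L'.addr := by
  induction k generalizing L with
  | zero => simp [Model.growTree]
  | succ k ih =>
    intro L' hL'
    unfold Model.growTree at hL'
    split_ifs at hL' with h
    · rcases List.mem_append.1 hL' with h1 | h1
      · exact (List.suffix_cons _ _).trans (ih _ _ h1)
      · exact (List.suffix_cons _ _).trans (ih _ _ h1)
    · rw [List.mem_singleton.1 hL']

lemma Model.growTree_pairwise (k : ℕ) (L : Node d) :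
    (M.growTree e k L).Pairwise Node.Incomparable := by
  induction k generalizing L with
  | zero => simp [Model.growTree]
  | succ k ih =>
    unfold Model.growTree
    split_ifs with h
    · refine List.pairwise_append.2 ⟨ih _, ih _, fun A hA B hB => ?_⟩
      exact Node.incomparable_of_suffix Bool.false_ne_true (M.growTree_suffix e k _ _ hA)
        (M.growTree_suffix e k _ _ hB)
    · simp

/-- A cut trades the weight `2^(-c)` for two weights `2^(-c-1)`. The conserved total is what later
turns bounds on the depths into bounds on the number of leaves. -/
lemma Model.growTree_kraft (k : ℕ) (L : Node d) :
    ((M.growTree e k L).map fun L' => (1 / 2 : ℝ) ^ L'.depth).sum = (1 / 2) ^ L.depth := by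
  induction k generalizing L with
  | zero => simp [Model.growTree]
  | succ k ih =>
    unfold Model.growTree
    split_ifs with h
    · rw [List.map_append, List.sum_append, ih, ih]
      simp only [Model.child_depth]
      ring
    · simp

lemma Model.growTree_sum_length (k : ℕ) (L : Node d) :
    ((M.growTree e k L).map fun L' => L'.smpI.length).sum = L.smpI.length := by
  induction k generalizing L with
  | zero => simp [Model.growTree]
  | succ k ih =>
    unfold Model.growTree
    split_ifs with h
    · rw [List.map_append, List.sum_append, ih, ih, Model.length_child_smpI_add]
    · simp

lemma Model.growTree_cover (k : ℕ) (L : Node d) {x : Pt d} (hx : x ∈ L.cell.region) :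
    ∃ L' ∈ M.growTree e k L, x ∈ L'.cell.region := by
  induction k generalizing L with
  | zero => exact ⟨L, by simp [Model.growTree], hx⟩
  | succ k ih =>
    unfold Model.growTree
    split_ifs with h
    · obtain ⟨b, hb⟩ := M.exists_child_mem e hx
      obtain ⟨L', h1, h2⟩ := ih _ hb
      refine ⟨L', ?_, h2⟩
      cases b
      · exact List.mem_append_left _ h1
      · exact List.mem_append_right _ h1
    · exact ⟨L, by simp, hx⟩

lemma Model.growTree_ne_nil (k : ℕ) (L : Node d) : M.growTree e k L ≠ [] := by
  intro h
  have := M.growTree_kraft e k L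
  have h2 : (0 : ℝ) < (1 / 2) ^ L.depth := by positivity
  rw [h, List.map_nil, List.sum_nil] at this
  linarith

lemma Model.growTree_valid (k : ℕ) (L : Node d) : ∀ L' ∈ M.growTree e k L, L'.valid → L.valid := by
  induction k generalizing L with
  | zero => simp [Model.growTree]
  | succ k ih =>
    intro L' hL' hv
    unfold Model.growTree at hL'
    split_ifs at hL' with h
    · rcases List.mem_append.1 hL' with h1 | h1
      · exact (ih _ _ h1 hv).1
      · exact (ih _ _ h1 hv).1
    · rwa [← List.mem_singleton.1 hL']

lemma Model.full_of_le {L : Node d} (h : M.f L.depth ≤ L.smpI.length) : M.full w L = L := if_pos h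

/-- A node split in Stage 1 already has enough samples, so `full` does nothing to it and its
children are the `born` ones. Each valid cut loses a sample on both sides, hence the fuel can only
run out at a node without samples, which is below its positive threshold. -/
lemma Model.growTree_born (hβ : 0 < M.β) (hf : ∀ c, 0 < M.f c) (k : ℕ) (a : List Bool)
    (hk : (M.born w e N₀ a).smpI.length ≤ k)
    (hv : ∀ L ∈ M.growTree e k (M.born w e N₀ a), L.valid) :
    ∀ L ∈ M.growTree e k (M.born w e N₀ a),
      L = M.born w e N₀ L.addr ∧ L.smpI.length < M.f L.depth := by
  induction k generalizing a with
  | zero =>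
    intro L hL
    rw [Model.growTree, List.mem_singleton] at hL
    subst hL
    have := hf (M.born w e N₀ a).depth
    exact ⟨by simp, by omega⟩
  | succ k ih =>
    unfold Model.growTree at hv ⊢
    split_ifs at hv ⊢ with h
    · have hb : ∀ b, M.child e (M.born w e N₀ a) b = M.born w e N₀ (b :: a) := fun b => by
        rw [Model.born, M.full_of_le w h]
      have hlt : ∀ b, (∀ L ∈ M.growTree e k (M.born w e N₀ (b :: a)), L.valid) →
          (M.born w e N₀ (b :: a)).smpI.length ≤ k := fun b hb' => by
        obtain ⟨L, hL⟩ := List.exists_mem_of_ne_nil _ (M.growTree_ne_nil e k (M.born w e N₀ (b :: a)))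
        have hv' := M.growTree_valid e k _ L hL (hb' L hL)
        rw [← hb] at hv' ⊢
        have := M.length_child_smpI_lt e hβ hf hv'
        omega
      rw [hb, hb] at hv ⊢
      have h1 := fun L hL => hv L (List.mem_append_left _ hL)
      have h2 := fun L hL => hv L (List.mem_append_right _ hL)
      intro L hL
      rcases List.mem_append.1 hL with hL | hL
      · exact ih _ (hlt _ h1) h1 L hL
      · exact ih _ (hlt _ h2) h2 L hL
    · intro L hL
      rw [List.mem_singleton] at hL
      subst hL
      exact ⟨by simp, by omega⟩

/-- The leaves of a state form a partition tree. -/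
structure State.IsTree (S : State d) : Prop where
  pairwise : S.leaves.Pairwise Node.Incomparable
  kraft : (S.leaves.map fun L => (1 / 2 : ℝ) ^ L.depth).sum = 1
  cover : ∀ x ∈ cube d, ∃ L ∈ S.leaves, x ∈ L.cell.region

lemma State.IsTree.ne_nil {S : State d} (h : S.IsTree) : S.leaves ≠ [] := by
  intro h0
  have := h.kraft
  rw [h0] at this
  simp at this

/-- A list is a suffix of itself, so incomparable leaves have distinct addresses, and filtering by
address removes the selected leaf and nothing else. -/
lemma perm_cons_filter_addr {l : List (Node d)} (h : l.Pairwise Node.Incomparable) {A : Node d}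
    (hA : A ∈ l) : l.Perm (A :: l.filter fun L => decide (L.addr ≠ A.addr)) := by
  induction l with
  | nil => simp at hA
  | cons x l ih =>
    rw [List.pairwise_cons] at h
    rcases List.mem_cons.1 hA with rfl | hA
    · have : l.filter (fun L => decide (L.addr ≠ A.addr)) = l := by
        refine List.filter_eq_self.2 fun L hL => ?_
        simp only [ne_eq, decide_not, Bool.not_eq_eq_eq_not, Bool.not_true, decide_eq_false_iff_not]
        intro h0
        exact (h.1 L hL).1 (by rw [h0])
      simp only [List.filter_cons, ne_eq, not_true_eq_false, decide_false, Bool.false_eq_true,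
        if_false]
      rw [this]
    · have hx : decide (x.addr ≠ A.addr) = true := by
        simp only [ne_eq, decide_not, Bool.not_eq_eq_eq_not, Bool.not_true, decide_eq_false_iff_not]
        intro h0
        exact (h.1 A hA).1 (by rw [h0])
      rw [List.filter_cons, if_pos hx]
      exact ((ih h.2 hA).cons x).trans (List.Perm.swap _ _ _)

/-- The leaves that are not touched by a step. -/
def State.others (S : State d) (A : Node d) : List (Node d) :=
  S.leaves.filter fun L => decide (L.addr ≠ A.addr)

lemma State.IsTree.perm {S : State d} (h : S.IsTree) (σ : Strategy d) :
    S.leaves.Perm (σ.pick S :: S.others (σ.pick S)) :=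
  perm_cons_filter_addr h.pairwise (σ.pick_mem S h.ne_nil)

/-- The leaves which replace the selected one. -/
def Model.replacement (A : Node d) : List (Node d) :=
  if (M.visit w A).smpI.length = M.f (M.visit w A).depth then
    [M.child e (M.topUp w (M.visit w A)) false, M.child e (M.topUp w (M.visit w A)) true]
  else [M.visit w A]

lemma Model.step_leaves (σ : Strategy d) (S : State d) :
    (M.step w e σ S).leaves = M.replacement w e (σ.pick S) ++ S.others (σ.pick S) := by
  unfold Model.step Model.replacement State.others
  dsimp only
  split_ifs <;> rfl

lemma Model.replacement_suffix (A : Node d) :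
    ∀ L ∈ M.replacement w e A, L.addr = A.addr ∨ ∃ b, L.addr = b :: A.addr := by
  intro L hL
  unfold Model.replacement at hL
  split_ifs at hL
  · rcases (by simpa using hL : _ ∨ _) with rfl | rfl
    · exact .inr ⟨false, rfl⟩
    · exact .inr ⟨true, rfl⟩
  · rw [List.mem_singleton] at hL
    subst hL
    exact .inl rfl

lemma Model.replacement_pairwise (A : Node d) :
    (M.replacement w e A).Pairwise Node.Incomparable := by
  unfold Model.replacement
  split_ifs
  · refine List.pairwise_pair.2 ?_
    exact Node.incomparable_of_suffix (a := A.addr) Bool.false_ne_true (List.suffix_refl _)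
      (List.suffix_refl _)
  · simp

lemma Node.Incomparable.symm {L L' : Node d} (h : L.Incomparable L') : L'.Incomparable L :=
  ⟨h.2, h.1⟩

lemma Model.step_isTree {σ : Strategy d} {S : State d} (h : S.IsTree) :
    (M.step w e σ S).IsTree where
  pairwise := by
    rw [Model.step_leaves]
    have hp := (h.perm σ).pairwise_iff (R := Node.Incomparable) (fun {_ _} => Node.Incomparable.symm)
    obtain ⟨h1, h2⟩ := List.pairwise_cons.1 (hp.1 h.pairwise)
    refine List.pairwise_append.2 ⟨M.replacement_pairwise w e _, h2, fun L hL L' hL' => ?_⟩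
    obtain ⟨h3, h4⟩ := h1 L' hL'
    rcases M.replacement_suffix w e _ L hL with h5 | ⟨b, h5⟩
    · exact ⟨by rwa [h5], by rwa [h5]⟩
    · refine ⟨fun hs => h3 ?_, fun hs => ?_⟩
      · rw [h5] at hs
        exact (List.suffix_cons _ _).trans hs
      · rw [h5] at hs
        rcases List.suffix_cons_iff.1 hs with h6 | h6
        · exact h3 (h6 ▸ List.suffix_cons _ _)
        · exact h4 h6
  kraft := by
    have hk := h.kraft
    rw [((h.perm σ).map _).sum_eq, List.map_cons, List.sum_cons] at hk
    rw [Model.step_leaves, List.map_append, List.sum_append]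
    refine Eq.trans ?_ hk
    congr 1
    unfold Model.replacement
    split_ifs
    · have : (M.topUp w (M.visit w (σ.pick S))).depth = (σ.pick S).depth := rfl
      simp only [List.map_cons, List.map_nil, List.sum_cons, List.sum_nil, Model.child_depth, this]
      ring
    · have : (M.visit w (σ.pick S)).depth = (σ.pick S).depth := rfl
      simp [this]
  cover := by
    intro x hx
    obtain ⟨L, hL, hxL⟩ := h.cover x hx
    rw [Model.step_leaves]
    rcases List.mem_cons.1 ((h.perm σ).mem_iff.1 hL) with rfl | hL
    · have : ∃ L ∈ M.replacement w e (σ.pick S), x ∈ L.cell.region := by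
        unfold Model.replacement
        split_ifs
        · obtain ⟨b, hb⟩ := M.exists_child_mem e (L := M.topUp w (M.visit w (σ.pick S))) hxL
          refine ⟨_, ?_, hb⟩
          cases b <;> simp
        · exact ⟨_, List.mem_singleton_self _, hxL⟩
      obtain ⟨L, h1, h2⟩ := this
      exact ⟨L, List.mem_append_left _ h1, h2⟩
    · exact ⟨L, List.mem_append_right _ hL, hxL⟩

/-- The number of samples of `𝓢_𝓘`. -/
def State.sizeI (S : State d) : ℕ := (S.leaves.map fun L => L.smpI.length).sum

lemma Model.step_sizeI {σ : Strategy d} {S : State d} (h : S.IsTree) :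
    (M.step w e σ S).sizeI = S.sizeI + 1 := by
  unfold State.sizeI
  rw [Model.step_leaves, ((h.perm σ).map _).sum_eq, List.map_append, List.sum_append,
    List.map_cons, List.sum_cons]
  have : ((M.replacement w e (σ.pick S)).map fun L => L.smpI.length).sum
      = (σ.pick S).smpI.length + 1 := by
    have hv : (M.visit w (σ.pick S)).smpI.length = (σ.pick S).smpI.length + 1 := by
      simp [Model.visit]
    unfold Model.replacement
    split_ifs
    · simp only [List.map_cons, List.map_nil, List.sum_cons, List.sum_nil]
      have := M.length_child_smpI_add e (M.topUp w (M.visit w (σ.pick S)))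
      rw [add_zero, this]
      exact hv
    · simpa using hv
  omega

lemma Model.lt_step_n (σ : Strategy d) (S : State d) : S.n + 1 ≤ (M.step w e σ S).n := by
  unfold Model.step
  dsimp only
  split_ifs
  · dsimp only; omega
  · exact le_rfl

/-- The number of simulations is controlled by the number of samples of `𝓢_𝓘` and by the size of
the tree. -/
def State.CountBound (S : State d) : Prop :=
  ∀ h, (∀ L ∈ S.leaves, L.depth ≤ h) → S.n ≤ 2 * S.sizeI + 1 + S.leaves.length * M.f h

/-- The at most `f(h)` simulations that top up `𝓢_𝓙` before a split are charged to the one leaf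
which the split adds; the simulation for `𝓢_𝓘` is charged to `sizeI`. -/
lemma Model.step_countBound (hmono : Monotone M.f) {σ : Strategy d} {S : State d} (h : S.IsTree)
    (hc : S.CountBound M) : (M.step w e σ S).CountBound M := by
  intro k hk
  have hlen := (h.perm σ).length_eq
  have h1 := M.step_sizeI w e (σ := σ) h
  have hk' : ∀ L ∈ M.replacement w e (σ.pick S), L.depth ≤ k := fun L hL =>
    hk L (by rw [Model.step_leaves]; exact List.mem_append_left _ hL)
  have hoth : ∀ L ∈ S.others (σ.pick S), L.depth ≤ k := fun L hL =>
    hk L (by rw [Model.step_leaves]; exact List.mem_append_right _ hL)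
  have hd : (σ.pick S).depth ≤ k := by
    unfold Model.replacement at hk'
    split_ifs at hk'
    · have := hk' _ (List.mem_cons_self)
      rw [Model.child_depth] at this
      exact (Nat.le_succ _).trans this
    · exact hk' (M.visit w (σ.pick S)) (List.mem_singleton_self _)
  have h2 := hc k fun L hL => by
    rcases List.mem_cons.1 ((h.perm σ).mem_iff.1 hL) with rfl | hL
    · exact hd
    · exact hoth L hL
  rw [h1, Model.step_leaves, List.length_append]
  rw [hlen, List.length_cons] at h2
  unfold Model.step Model.replacement
  dsimp only
  split_ifs
  · have h3 : M.missing (M.visit w (σ.pick S)) ≤ M.f k :=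
      (Nat.sub_le _ _).trans (hmono hd)
    simp only [List.length_cons, List.length_nil]
    nlinarith
  · simp only [List.length_cons, List.length_nil]
    nlinarith

/-- Every leaf consists of a node at its creation, and of visits to it; it has too few samples to be
split. -/
def State.Reached (S : State d) : Prop :=
  ∀ L ∈ S.leaves, (∃ k, L = (M.visit w)^[k] (M.born w e N₀ L.addr)) ∧
    L.smpI.length < M.f L.depth

lemma Model.valid_of_step_valid {σ : Strategy d} {S : State d} (h : S.IsTree)
    (hv : (M.step w e σ S).Valid) : S.Valid := by
  intro L hL
  rcases List.mem_cons.1 ((h.perm σ).mem_iff.1 hL) with rfl | hL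
  · have : ∀ L ∈ M.replacement w e (σ.pick S), L.valid := fun L hL =>
      hv L (by rw [Model.step_leaves]; exact List.mem_append_left _ hL)
    unfold Model.replacement at this
    split_ifs at this
    · exact (this _ (List.mem_cons_self)).1
    · exact this (M.visit w (σ.pick S)) (List.mem_singleton_self _)
  · exact hv L (by rw [Model.step_leaves]; exact List.mem_append_right _ hL)

/-- Stage 2 splits when the count equals `f(c)`, exactly where `full` stops visiting, so the node
being split is `full` of its `born` version. A child has fewer than `f(c) ≤ f(c+1)` samples, so no
split triggers another one. -/
lemma Model.step_reached (hβ : 0 < M.β) (hf : ∀ c, 0 < M.f c) (hmono : Monotone M.f)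
    {σ : Strategy d} {S : State d} (h : S.IsTree) (hv : (M.step w e σ S).Valid)
    (hr : S.Reached M w e N₀) : (M.step w e σ S).Reached M w e N₀ := by
  intro L hL
  have hvL := hv L hL
  rw [Model.step_leaves] at hL
  rcases List.mem_append.1 hL with hL | hL
  · obtain ⟨⟨k, hk⟩, hlt⟩ := hr _ ((h.perm σ).mem_iff.2 List.mem_cons_self)
    set A := σ.pick S with hA
    have hvis : M.visit w A = (M.visit w)^[k + 1] (M.born w e N₀ A.addr) := by
      rw [Function.iterate_succ_apply', ← hk]
    have hlen : (M.visit w A).smpI.length = A.smpI.length + 1 := by simp [Model.visit]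
    unfold Model.replacement at hL
    split_ifs at hL with hs
    · have hd : (M.visit w A).depth = A.addr.length := rfl
      have hd' : A.depth = A.addr.length := rfl
      rw [hd] at hs
      rw [hd'] at hlt
      have hAl : A.smpI.length = (M.born w e N₀ A.addr).smpI.length + k := by
        conv_lhs => rw [hk, Model.visit_iterate_smpI]
        simp
      have hfull : M.topUp w (M.visit w A) = M.full w (M.born w e N₀ A.addr) := by
        unfold Model.full
        rw [if_neg, hvis]
        · congr 3
          rw [Model.born_depth]
          omega
        · rw [Model.born_depth]
          omega
      have key : ∀ b, L = M.child e (M.topUp w (M.visit w A)) b →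
          L = M.born w e N₀ (b :: A.addr) ∧ L.smpI.length < M.f L.depth := by
        rintro b rfl
        refine ⟨by rw [hfull]; rfl, ?_⟩
        have h1 := M.length_child_smpI_lt e hβ hf hvL
        have h2 : (M.topUp w (M.visit w A)).smpI.length = (M.visit w A).smpI.length := rfl
        have h3 : M.f (M.visit w A).depth ≤ M.f ((M.topUp w (M.visit w A)).depth + 1) :=
          hmono (Nat.le_succ _)
        rw [hd] at h3
        rw [Model.child_depth]
        omega
      rcases (by simpa using hL : _ ∨ _) with hL | hL
      · obtain ⟨h1, h2⟩ := key false hL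
        refine ⟨⟨0, ?_⟩, h2⟩
        rw [h1]; simp
      · obtain ⟨h1, h2⟩ := key true hL
        refine ⟨⟨0, ?_⟩, h2⟩
        rw [h1]; simp
    · rw [List.mem_singleton] at hL
      subst hL
      refine ⟨⟨k + 1, hvis⟩, ?_⟩
      have : (M.visit w A).depth = A.depth := rfl
      rw [this] at hs ⊢
      omega
  · exact hr L ((h.perm σ).mem_iff.2 (List.mem_cons_of_mem _ hL))

lemma Model.stageOne_isTree : (M.stageOne w e N₀).IsTree where
  pairwise := M.growTree_pairwise e _ _
  kraft := by
    have := M.growTree_kraft e (M.rootNode w N₀).smpI.length (M.rootNode w N₀)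
    simpa [Model.stageOne, Model.rootNode, Node.depth] using this
  cover x hx := M.growTree_cover e _ (M.rootNode w N₀) hx

lemma Model.length_rootNode_smpI : (M.rootNode w N₀).smpI.length = N₀ / 2 := by
  simp [Model.rootNode]; omega

lemma Model.stageOne_sizeI : (M.stageOne w e N₀).sizeI = N₀ / 2 := by
  rw [← M.length_rootNode_smpI w N₀]
  exact M.growTree_sum_length e _ _

lemma Model.stageOne_reached (hβ : 0 < M.β) (hf : ∀ c, 0 < M.f c)
    (hv : (M.stageOne w e N₀).Valid) : (M.stageOne w e N₀).Reached M w e N₀ := by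
  intro L hL
  obtain ⟨h1, h2⟩ := M.growTree_born w e N₀ hβ hf _ [] le_rfl hv L hL
  exact ⟨⟨0, h1⟩, h2⟩

/-- What is known about the state after any number of iterations of Stage 2. -/
structure Model.Sound (S : State d) : Prop where
  isTree : S.IsTree
  countBound : S.CountBound M
  reached : S.Valid → S.Reached M w e N₀

lemma Model.iterate_sound (hβ : 0 < M.β) (hf : ∀ c, 0 < M.f c) (hmono : Monotone M.f)
    (σ : Strategy d) (N k : ℕ) :
    let S := (fun S => if S.n < N then M.step w e σ S else S)^[k] (M.stageOne w e N₀)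
    M.Sound w e N₀ S ∧ S.sizeI ≤ N₀ + k ∧ min N k ≤ S.n := by
  induction k with
  | zero =>
    refine ⟨⟨M.stageOne_isTree w e N₀, fun h _ => ?_, M.stageOne_reached w e N₀ hβ hf⟩, ?_, ?_⟩
    · have := M.stageOne_sizeI w e N₀
      have h2 : (M.stageOne w e N₀).n = N₀ := rfl
      simp only [Function.iterate_zero, id_eq]
      rw [this, h2]
      -- The additive `1` in `CountBound` accounts for an odd `N₀`.
      have : N₀ ≤ 2 * (N₀ / 2) + 1 := by omega
      exact this.trans (Nat.le_add_right _ _)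
    · have := M.stageOne_sizeI w e N₀
      simp only [Function.iterate_zero, id_eq]
      omega
    · simp
  | succ k ih =>
    obtain ⟨ih, ih2, ih3⟩ := ih
    dsimp only
    rw [Function.iterate_succ_apply']
    set S := (fun S => if S.n < N then M.step w e σ S else S)^[k] (M.stageOne w e N₀)
    split_ifs with hN
    · refine ⟨⟨M.step_isTree w e ih.isTree, M.step_countBound w e hmono ih.isTree ih.countBound,
        fun hv => M.step_reached w e N₀ hβ hf hmono ih.isTree hv
          (ih.reached (M.valid_of_step_valid w e ih.isTree hv))⟩, ?_, ?_⟩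
      · rw [M.step_sizeI w e ih.isTree]; omega
      · have := M.lt_step_n w e σ S
        omega
    · refine ⟨ih, by omega, by omega⟩


lemma Model.run_sound (hβ : 0 < M.β) (hf : ∀ c, 0 < M.f c) (hmono : Monotone M.f)
    (σ : Strategy d) (N : ℕ) : M.Sound w e N₀ (M.run w e σ N₀ N) :=
  (M.iterate_sound w e N₀ hβ hf hmono σ N N).1

lemma Model.run_sizeI_le (hβ : 0 < M.β) (hf : ∀ c, 0 < M.f c) (hmono : Monotone M.f)
    (σ : Strategy d) (N : ℕ) : (M.run w e σ N₀ N).sizeI ≤ N₀ + N :=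
  (M.iterate_sound w e N₀ hβ hf hmono σ N N).2.1

lemma Model.le_run_n (hβ : 0 < M.β) (hf : ∀ c, 0 < M.f c) (hmono : Monotone M.f)
    (σ : Strategy d) (N : ℕ) : N ≤ (M.run w e σ N₀ N).n :=
  (le_min le_rfl le_rfl).trans (M.iterate_sound w e N₀ hβ hf hmono σ N N).2.2

end Invariants

/-! ### Geometry of the cells -/

section Geometry

variable {d : ℕ} {V : Type*} (M : Model d V) (w : Input → (Fin d → ℝ) × V)
  (e : List Bool → Bool × Fin d) (N₀ : ℕ)

/-- A cell is a hyperrectangle with nonempty interior up to its lower faces. -/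
structure Cell.Proper (B : Cell d) : Prop where
  lt : ∀ i, B.lo i < B.hi i
  region_subset : ∀ x ∈ B.region, ∀ i, B.lo i ≤ x i ∧ x i ≤ B.hi i
  subset_region : ∀ x : Pt d, (∀ i, B.lo i < x i ∧ x i ≤ B.hi i) → x ∈ B.region

lemma Cell.proper_root : (Cell.root d).Proper where
  lt i := by simp [Cell.root]
  region_subset x hx i := hx i
  subset_region x hx i := ⟨(hx i).1.le, (hx i).2⟩

lemma Cell.Proper.child {B : Cell d} (hB : B.Proper) {j : Fin d} {z : ℝ} (h1 : B.lo j < z)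
    (h2 : z < B.hi j) (b : Bool) : (B.child j z b).Proper := by
  cases b
  · refine ⟨fun i => ?_, fun x hx i => ?_, fun x hx => ⟨?_, ?_⟩⟩
    · rcases eq_or_ne i j with rfl | hij
      · simpa [Cell.child] using h1
      · simpa [Cell.child, hij] using hB.lt i
    · refine ⟨(hB.region_subset x hx.1 i).1, ?_⟩
      rcases eq_or_ne i j with rfl | hij
      · simpa [Cell.child] using hx.2
      · simpa [Cell.child, hij] using (hB.region_subset x hx.1 i).2
    · refine hB.subset_region x fun i => ⟨(hx i).1, ?_⟩
      rcases eq_or_ne i j with rfl | hij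
      · have := (hx i).2
        simp only [Cell.child, Function.update_self] at this
        linarith
      · simpa [Cell.child, hij] using (hx i).2
    · simpa [Cell.child] using (hx j).2
  · refine ⟨fun i => ?_, fun x hx i => ?_, fun x hx => ⟨?_, ?_⟩⟩
    · rcases eq_or_ne i j with rfl | hij
      · simpa [Cell.child] using h2
      · simpa [Cell.child, hij] using hB.lt i
    · refine ⟨?_, (hB.region_subset x hx.1 i).2⟩
      rcases eq_or_ne i j with rfl | hij
      · simpa [Cell.child] using le_of_lt hx.2
      · simpa [Cell.child, hij] using (hB.region_subset x hx.1 i).1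
    · refine hB.subset_region x fun i => ⟨?_, (hx i).2⟩
      rcases eq_or_ne i j with rfl | hij
      · have := (hx i).1
        simp only [Cell.child, Function.update_self] at this
        linarith
      · simpa [Cell.child, hij] using (hx i).1
    · simpa [Cell.child] using (hx j).1

lemma Cell.child_side_le (B : Cell d) {j : Fin d} {z : ℝ} (h1 : B.lo j < z) (h2 : z < B.hi j)
    (b : Bool) (i : Fin d) :
    (B.child j z b).hi i - (B.child j z b).lo i ≤ B.hi i - B.lo i := by
  rcases eq_or_ne i j with rfl | hij
  · cases b <;> simp only [Cell.child, Function.update_self] <;> linarith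
  · cases b <;> simp [Cell.child, hij]

/-- Positivity of the relative coordinates matters: a lower face created by a cut belongs to the
sibling cell. -/
lemma Cell.Proper.place_mem {B : Cell d} (hB : B.Proper) {u : Fin d → ℝ}
    (hu : ∀ j, 0 < u j ∧ u j ≤ 1) : B.place u ∈ B.region := by
  refine hB.subset_region _ fun i => ?_
  have h1 := hB.lt i
  simp only [Cell.place]
  constructor <;> nlinarith [hu i, mul_pos (hu i).1 (sub_pos.2 h1)]

lemma Model.child_cell (L : Node d) (b : Bool) :
    (M.child e L b).cell = L.cell.child (M.cut e L).1 (M.cut e L).2 b := rfl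

lemma Model.cut_mem_of_child_valid (hα : 0 < M.α) {L : Node d} {b : Bool}
    (h : (M.child e L b).valid) (hL : L.cell.Proper) :
    L.cell.lo (M.cut e L).1 < (M.cut e L).2 ∧ (M.cut e L).2 < L.cell.hi (M.cut e L).1 := by
  obtain ⟨-, h1, h2, -⟩ := h
  have h3 := hL.lt (M.cut e L).1
  simp only [Model.splitData] at h1 h2
  constructor <;> nlinarith [mul_pos hα (sub_pos.2 h3)]

lemma Model.born_valid_of_cons {b : Bool} {a : List Bool} (h : (M.born w e N₀ (b :: a)).valid) :
    (M.born w e N₀ a).valid := by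
  simpa using h.1

lemma Model.born_proper (hα : 0 < M.α) (a : List Bool) (h : (M.born w e N₀ a).valid) :
    (M.born w e N₀ a).cell.Proper := by
  induction a with
  | nil => exact Cell.proper_root
  | cons b a ih =>
    have h1 := ih (M.born_valid_of_cons w e N₀ h)
    have h2 : (M.full w (M.born w e N₀ a)).cell.Proper := by simpa using h1
    obtain ⟨h3, h4⟩ := M.cut_mem_of_child_valid e hα (b := b) h h2
    rw [Model.born, Model.child_cell]
    exact h2.child h3 h4 b

/-- The number of ancestors of `a` whose cut is along `j` because of the random choice. -/
def cutCount (j : Fin d) : List Bool → ℕ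
  | [] => 0
  | _ :: a => (if e a = (true, j) then 1 else 0) + cutCount j a

/-- A cut along `j` leaves at most the fraction `1 - α` of that side, and no cut lengthens a side.
Only the coin-forced cuts are counted, since the coordinates of the others are chosen by the data
and cannot be controlled. -/
lemma Model.side_le (hα : 0 < M.α) (hα' : M.α ≤ 1 / 2) (a : List Bool)
    (h : (M.born w e N₀ a).valid) (j : Fin d) :
    (M.born w e N₀ a).cell.hi j - (M.born w e N₀ a).cell.lo j ≤ (1 - M.α) ^ cutCount e j a := by
  induction a with
  | nil => simp [Model.born, Model.rootNode, Cell.root, cutCount]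
  | cons b a ih =>
    have hv := M.born_valid_of_cons w e N₀ h
    have h1 := ih hv
    have hp := M.born_proper w e N₀ hα a hv
    set L := M.full w (M.born w e N₀ a) with hL
    have hp' : L.cell.Proper := by simpa [hL] using hp
    obtain ⟨h3, h4⟩ := M.cut_mem_of_child_valid e hα (b := b) h hp'
    have hcell : (M.born w e N₀ a).cell = L.cell := by simp [hL]
    rw [hcell] at h1
    have hmono : (M.born w e N₀ (b :: a)).cell.hi j - (M.born w e N₀ (b :: a)).cell.lo j ≤
        (L.cell.hi j - L.cell.lo j) := by
      rw [Model.born, Model.child_cell]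
      exact L.cell.child_side_le h3 h4 b j
    rw [cutCount]
    split_ifs with he
    · have hj : (M.cut e L).1 = j := by
        have : e L.addr = (true, j) := by simpa [hL] using he
        simp [Model.cut, this]
      obtain ⟨-, f1, f2, -⟩ := h
      simp only [Model.splitData] at f1 f2
      change (1 - M.α) * L.cell.lo (M.cut e L).1 + M.α * L.cell.hi (M.cut e L).1 ≤ (M.cut e L).2 at f1
      change (M.cut e L).2 ≤ M.α * L.cell.lo (M.cut e L).1 + (1 - M.α) * L.cell.hi (M.cut e L).1 at f2
      rw [hj] at f1 f2
      have hshrink : (M.born w e N₀ (b :: a)).cell.hi j - (M.born w e N₀ (b :: a)).cell.lo j ≤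
          (1 - M.α) * (L.cell.hi j - L.cell.lo j) := by
        rw [Model.born, Model.child_cell, ← hL, hj]
        cases b <;> simp [Cell.child] <;> linarith
      refine hshrink.trans ?_
      rw [add_comm, pow_succ, mul_comm]
      exact mul_le_mul_of_nonneg_right h1 (by linarith)
    · rw [zero_add]
      exact hmono.trans h1

/-- The address of the node of depth `k` that contains `x`. -/
def Model.pathTo (x : Pt d) : ℕ → List Bool
  | 0 => []
  | k + 1 =>
    decide ((M.cut e (M.full w (M.born w e N₀ (Model.pathTo x k)))).2 <
      x (M.cut e (M.full w (M.born w e N₀ (Model.pathTo x k)))).1) :: Model.pathTo x k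

@[simp] lemma Model.length_pathTo (x : Pt d) (k : ℕ) : (M.pathTo w e N₀ x k).length = k := by
  induction k with
  | zero => rfl
  | succ k ih => simp [Model.pathTo, ih]

/-- The cells of the infinite tree that contain `x` form a single branch. Whatever the strategy
does, the leaf of `x` is on this branch, which is fixed by the inputs. -/
lemma Model.eq_pathTo {x : Pt d} (a : List Bool) (hx : x ∈ (M.born w e N₀ a).cell.region) :
    a = M.pathTo w e N₀ x a.length := by
  induction a with
  | nil => rfl
  | cons b a ih =>
    rw [Model.born, Model.child_cell] at hx
    have hxa : x ∈ (M.born w e N₀ a).cell.region := by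
      cases b <;> simpa using hx.1
    rw [List.length_cons, Model.pathTo, ← ih hxa]
    congr 1
    cases b
    · have : x (M.cut e (M.full w (M.born w e N₀ a))).1 ≤
        (M.cut e (M.full w (M.born w e N₀ a))).2 := hx.2
      simpa using this
    · have : (M.cut e (M.full w (M.born w e N₀ a))).2 <
        x (M.cut e (M.full w (M.born w e N₀ a))).1 := hx.2
      simpa using this

lemma Model.cutCount_pathTo_mono (x : Pt d) (j : Fin d) :
    Monotone fun k => cutCount e j (M.pathTo w e N₀ x k) :=
  monotone_nat_of_le_succ fun k => by simp [Model.pathTo, cutCount]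

lemma Model.smpI_mem_region (hα : 0 < M.α) (hu : ∀ i j, 0 < (w i).1 j ∧ (w i).1 j ≤ 1)
    (a : List Bool) (h : (M.born w e N₀ a).valid) :
    ∀ p ∈ (M.born w e N₀ a).smpI, p.1 ∈ (M.born w e N₀ a).cell.region := by
  induction a with
  | nil =>
    intro p hp
    obtain ⟨i, -, rfl⟩ := List.mem_map.1 (List.mem_of_mem_take hp)
    exact Cell.proper_root.place_mem (hu _)
  | cons b a ih =>
    have hv := M.born_valid_of_cons w e N₀ h
    have h1 := ih hv
    have hp := M.born_proper w e N₀ hα a hv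
    have h2 : ∀ p ∈ (M.full w (M.born w e N₀ a)).smpI,
        p.1 ∈ (M.full w (M.born w e N₀ a)).cell.region := by
      intro p hp'
      rw [Model.full_smpI] at hp'
      rw [Model.full_cell]
      rcases List.mem_append.1 hp' with hp' | hp'
      · exact h1 p hp'
      · obtain ⟨i, -, rfl⟩ := List.mem_map.1 hp'
        exact hp.place_mem (hu _)
    intro p hp'
    have hp'' := List.mem_filter.1 hp'
    cases b
    · exact ⟨h2 p hp''.1, by simpa using hp''.2⟩
    · exact ⟨h2 p hp''.1, by simpa using hp''.2⟩

lemma Model.smpI_mem_region_of_visit (hα : 0 < M.α)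
    (hu : ∀ i j, 0 < (w i).1 j ∧ (w i).1 j ≤ 1) (a : List Bool) (h : (M.born w e N₀ a).valid)
    (k : ℕ) : ∀ p ∈ ((M.visit w)^[k] (M.born w e N₀ a)).smpI,
      p.1 ∈ (M.born w e N₀ a).cell.region := by
  intro p hp
  rw [Model.visit_iterate_smpI] at hp
  rcases List.mem_append.1 hp with hp | hp
  · exact M.smpI_mem_region w e N₀ hα hu a h p hp
  · obtain ⟨i, -, rfl⟩ := List.mem_map.1 hp
    exact (M.born_proper w e N₀ hα a h).place_mem (hu _)

end Geometry

/-! ### Names of the samples in a node -/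

section Tags

variable {d : ℕ} {V : Type*} (M : Model d V) (w : Input → (Fin d → ℝ) × V)
  (e : List Bool → Bool × Fin d) (N₀ : ℕ)

/-- The cell from which the sample with a given name is drawn. -/
def Model.cellOf : Input → Cell d
  | .first _ => Cell.root d
  | .est a _ => (M.born w e N₀ a).cell
  | .grow a _ => (M.born w e N₀ a).cell

/-- The position of the sample with a given name. -/
def Model.pos (i : Input) : Pt d := (M.cellOf w e N₀ i).place (w i).1

/-- The sample with a given name. -/
def Model.samp (i : Input) : Pt d × ℝ := M.sample (M.cellOf w e N₀ i) (w i)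

/-- Membership in a side of a cut. -/
def keepSide (c : Fin d × ℝ) (b : Bool) (x : Pt d) : Bool :=
  if b then decide (c.2 < x c.1) else decide (x c.1 ≤ c.2)

/-- The cut of the node with address `a`. -/
def Model.cutAt (a : List Bool) : Fin d × ℝ := M.cut e (M.full w (M.born w e N₀ a))

/-- The names of the samples of `𝓢_𝓘` in a node after its visits, given those at its creation. -/
def Model.extendI (a : List Bool) (l : List Input) : List Input :=
  l ++ (List.range (M.f a.length - l.length)).map (.est a)

/-- The names of the samples of `𝓢_𝓙` in a node at its split, given those at its creation. -/
def Model.extendJ (a : List Bool) (l l' : List Input) : List Input :=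
  l' ++ (List.range (if M.f a.length ≤ l.length then 0 else M.f a.length - l'.length)).map (.grow a)

/-- The names of the samples of `𝓢_𝓘` in a node at its creation. -/
def Model.tagI : List Bool → List Input
  | [] => (List.range (N₀ / 2)).map .first
  | b :: a => (M.extendI a (Model.tagI a)).filter
      fun i => keepSide (M.cutAt w e N₀ a) b (M.pos w e N₀ i)

/-- The names of the samples of `𝓢_𝓙` in a node at its creation. -/
def Model.tagJ : List Bool → List Input
  | [] => ((List.range N₀).drop (N₀ / 2)).map .first
  | b :: a => (M.extendJ a (M.tagI w e N₀ a) (Model.tagJ a)).filter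
      fun i => keepSide (M.cutAt w e N₀ a) b (M.pos w e N₀ i)

/-- Separates which inputs feed a node from the values of these inputs: the names form a discrete
random variable that can be frozen before the seeds are looked at. -/
lemma Model.born_smp (a : List Bool) :
    (M.born w e N₀ a).smpI = (M.tagI w e N₀ a).map (M.samp w e N₀) ∧
    (M.born w e N₀ a).smpJ = (M.tagJ w e N₀ a).map (M.samp w e N₀) := by
  induction a with
  | nil =>
    constructor
    · simp only [Model.born, Model.rootNode, Model.tagI, List.map_map, ← List.map_take]
      rw [List.take_range, min_eq_left (Nat.div_le_self _ _)]
      rfl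
    · simp only [Model.born, Model.rootNode, Model.tagJ, List.map_map, ← List.map_drop]
      rfl
  | cons b a ih =>
    obtain ⟨h1, h2⟩ := ih
    have key : ∀ l : List Input, (l.filter
        fun i => keepSide (M.cutAt w e N₀ a) b (M.pos w e N₀ i)).map (M.samp w e N₀) =
        (l.map (M.samp w e N₀)).filter fun p => keepSide (M.cutAt w e N₀ a) b p.1 := by
      intro l
      rw [List.filter_map]
      rfl
    constructor
    · rw [Model.tagI, key, Model.extendI, List.map_append, ← h1, List.map_map]
      change (M.full w (M.born w e N₀ a)).smpI.filter _ = _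
      rw [Model.full_smpI]
      congr 2
      simp [h1]
      intro i _
      rfl
    · rw [Model.tagJ, key, Model.extendJ, List.map_append, ← h2, List.map_map]
      change (M.full w (M.born w e N₀ a)).smpJ.filter _ = _
      rw [Model.full_smpJ]
      congr 2
      simp [h1, h2]
      intro i _
      rfl

lemma Model.visit_smpI (a : List Bool) (k : ℕ) : ((M.visit w)^[k] (M.born w e N₀ a)).smpI =
    (M.tagI w e N₀ a ++ (List.range k).map (Input.est a)).map (M.samp w e N₀) := by
  rw [Model.visit_iterate_smpI, List.map_append, (M.born_smp w e N₀ a).1, List.map_map]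
  congr 1
  simp
  intro i _
  rfl

lemma Model.splitData_full (a : List Bool) : M.splitData (M.full w (M.born w e N₀ a)) =
    ⟨M.f a.length, (M.born w e N₀ a).cell.lo, (M.born w e N₀ a).cell.hi,
      (M.extendI a (M.tagI w e N₀ a)).map (M.pos w e N₀),
      (M.extendJ a (M.tagI w e N₀ a) (M.tagJ w e N₀ a)).map (M.samp w e N₀)⟩ := by
  obtain ⟨h1, h2⟩ := M.born_smp w e N₀ a
  simp only [Model.splitData, Model.full_depth, Model.born_depth, Model.full_cell,
    SplitData.mk.injEq, true_and]
  constructor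
  · rw [Model.full_smpI, Model.extendI, List.map_append, h1]
    simp
    constructor
  · rw [Model.full_smpJ, Model.extendJ, List.map_append, h1, h2]
    simp
    intro i _
    rfl

lemma Model.tagI_level (a : List Bool) : ∀ i ∈ M.tagI w e N₀ a,
    (∃ n < N₀ / 2, i = .first n) ∨ ∃ b n, b.length < a.length ∧ i = .est b n := by
  induction a with
  | nil =>
    intro i hi
    obtain ⟨n, hn, rfl⟩ := List.mem_map.1 hi
    exact .inl ⟨n, List.mem_range.1 hn, rfl⟩
  | cons b a ih =>
    intro i hi
    rcases List.mem_append.1 (List.mem_of_mem_filter hi) with h | h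
    · rcases ih i h with h | ⟨c, n, h1, h2⟩
      · exact .inl h
      · exact .inr ⟨c, n, h1.trans (Nat.lt_succ_self _), h2⟩
    · obtain ⟨n, -, rfl⟩ := List.mem_map.1 h
      exact .inr ⟨a, n, Nat.lt_succ_self _, rfl⟩

lemma Model.tagJ_level (a : List Bool) : ∀ i ∈ M.tagJ w e N₀ a,
    (∃ n, N₀ / 2 ≤ n ∧ i = .first n) ∨ ∃ b n, b.length < a.length ∧ i = .grow b n := by
  induction a with
  | nil =>
    intro i hi
    obtain ⟨n, hn, rfl⟩ := List.mem_map.1 hi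
    refine .inl ⟨n, ?_, rfl⟩
    rw [List.mem_drop_iff_getElem] at hn
    obtain ⟨k, hk, rfl⟩ := hn
    simp
  | cons b a ih =>
    intro i hi
    rcases List.mem_append.1 (List.mem_of_mem_filter hi) with h | h
    · rcases ih i h with h | ⟨c, n, h1, h2⟩
      · exact .inl h
      · exact .inr ⟨c, n, h1.trans (Nat.lt_succ_self _), h2⟩
    · obtain ⟨n, -, rfl⟩ := List.mem_map.1 h
      exact .inr ⟨a, n, Nat.lt_succ_self _, rfl⟩

/-- Names inherited from above are Stage 1 names or carry an address shorter than `a`, the new ones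
carry `a`. Without repetitions, the noise terms in a node use distinct, hence independent, inputs.
-/
lemma Model.nodup_tagI_append (a : List Bool) (h : (M.tagI w e N₀ a).Nodup) (k : ℕ) :
    (M.tagI w e N₀ a ++ (List.range k).map (Input.est a)).Nodup := by
  refine List.nodup_append'.2 ⟨h, List.nodup_range.map fun m n hmn => by simpa using hmn, ?_⟩
  intro i hi hi'
  obtain ⟨n, -, rfl⟩ := List.mem_map.1 hi'
  rcases M.tagI_level w e N₀ a _ hi with ⟨m, -, h⟩ | ⟨b, m, h1, h2⟩
  · cases h
  · cases h2
    exact lt_irrefl _ h1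

lemma Model.nodup_tagI (a : List Bool) : (M.tagI w e N₀ a).Nodup := by
  induction a with
  | nil => exact List.nodup_range.map fun m n hmn => by simpa using hmn
  | cons b a ih => exact (M.nodup_tagI_append w e N₀ a ih _).filter _

end Tags

/-! ### What the tree depends on -/

section Honesty

variable {d : ℕ} {V : Type*} (M : Model d V) {w w' : Input → (Fin d → ℝ) × V}
  {e e' : List Bool → Bool × Fin d} (N₀ : ℕ)

/-- The names of samples for `𝓢_𝓘`. -/
def isI : Input → Bool
  | .first n => decide (n < N₀ / 2)
  | .est _ _ => true
  | .grow _ _ => false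

lemma Model.cut_congr {L L' : Node d} (h1 : L.addr = L'.addr) (h2 : L.cell = L'.cell)
    (h3 : L.smpI.map Prod.fst = L'.smpI.map Prod.fst) (h4 : L.smpJ = L'.smpJ) :
    M.cut e L = M.cut e L' := by
  have : M.splitData L = M.splitData L' := by
    simp [Model.splitData, Node.depth, h1, h2, h3, h4]
  simp [Model.cut, this, h1]

/-- This is honesty. The cut sees the positions of the `𝓘`-samples and the full `𝓙`-samples; the
distribution of samples to the children and the number of samples to be added use only positions and
counts. Induction along the address carries the agreement down the tree. -/
lemma Model.born_congr_seed (hw : ∀ i, (w i).1 = (w' i).1 ∧ (isI N₀ i = false → w i = w' i))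
    (a : List Bool) :
    (M.born w e N₀ a).cell = (M.born w' e N₀ a).cell ∧
    (M.born w e N₀ a).smpI.map Prod.fst = (M.born w' e N₀ a).smpI.map Prod.fst ∧
    (M.born w e N₀ a).smpJ = (M.born w' e N₀ a).smpJ ∧
    M.cutAt w e N₀ a = M.cutAt w' e N₀ a := by
  have hfull : ∀ a, (M.born w e N₀ a).cell = (M.born w' e N₀ a).cell →
      (M.born w e N₀ a).smpI.map Prod.fst = (M.born w' e N₀ a).smpI.map Prod.fst →
      (M.born w e N₀ a).smpJ = (M.born w' e N₀ a).smpJ →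
      (M.full w (M.born w e N₀ a)).smpI.map Prod.fst =
        (M.full w' (M.born w' e N₀ a)).smpI.map Prod.fst ∧
      (M.full w (M.born w e N₀ a)).smpJ = (M.full w' (M.born w' e N₀ a)).smpJ := by
    intro a h1 h2 h3
    have hlen : (M.born w e N₀ a).smpI.length = (M.born w' e N₀ a).smpI.length := by
      simpa using congrArg List.length h2
    constructor
    · rw [Model.full_smpI, Model.full_smpI, List.map_append, List.map_append, h2, hlen]
      simp [Model.sample, h1, hw]
    · rw [Model.full_smpJ, Model.full_smpJ, h3, hlen]
      simp only [Model.born_depth, Model.born_addr, h1]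
      congr 1
      refine List.map_congr_left fun i _ => ?_
      rw [(hw _).2 rfl]
  have hcut : ∀ a, (M.born w e N₀ a).cell = (M.born w' e N₀ a).cell →
      (M.born w e N₀ a).smpI.map Prod.fst = (M.born w' e N₀ a).smpI.map Prod.fst →
      (M.born w e N₀ a).smpJ = (M.born w' e N₀ a).smpJ →
      M.cutAt w e N₀ a = M.cutAt w' e N₀ a := fun a h1 h2 h3 =>
    M.cut_congr (by simp) (by simpa using h1) (hfull a h1 h2 h3).1 (hfull a h1 h2 h3).2
  induction a with
  | nil =>
    have h1 : (M.born w e N₀ []).cell = (M.born w' e N₀ []).cell := rfl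
    have h2 : (M.born w e N₀ []).smpI.map Prod.fst = (M.born w' e N₀ []).smpI.map Prod.fst := by
      simp only [Model.born, Model.rootNode, ← List.map_take, List.map_map]
      refine List.map_congr_left fun i _ => ?_
      simp [Model.sample, hw]
    have h3 : (M.born w e N₀ []).smpJ = (M.born w' e N₀ []).smpJ := by
      simp only [Model.born, Model.rootNode, ← List.map_drop]
      refine List.map_congr_left fun i hi => ?_
      rw [List.mem_drop_iff_getElem] at hi
      obtain ⟨k, hk, rfl⟩ := hi
      rw [(hw _).2]
      simp [isI]
    exact ⟨h1, h2, h3, hcut _ h1 h2 h3⟩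
  | cons b a ih =>
    obtain ⟨i1, i2, i3, i4⟩ := ih
    obtain ⟨i5, i6⟩ := hfull a i1 i2 i3
    unfold Model.cutAt at i4
    have hkeep : ∀ (l l' : List (Pt d × ℝ)) (p : Pt d → Bool),
        l.map Prod.fst = l'.map Prod.fst →
        (l.filter fun q => p q.1).map Prod.fst = (l'.filter fun q => p q.1).map Prod.fst := by
      intro l l' p h
      have := congrArg (List.filter p) h
      rwa [List.filter_map, List.filter_map] at this
    have h1 : (M.born w e N₀ (b :: a)).cell = (M.born w' e N₀ (b :: a)).cell := by
      simp only [Model.born, Model.child_cell, i4, Model.full_cell, i1]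
    have h2 : (M.born w e N₀ (b :: a)).smpI.map Prod.fst =
        (M.born w' e N₀ (b :: a)).smpI.map Prod.fst := by
      simp only [Model.born, Model.child, i4]
      exact hkeep _ _ (fun x => if b then decide (_ < x _) else decide (x _ ≤ _)) i5
    have h3 : (M.born w e N₀ (b :: a)).smpJ = (M.born w' e N₀ (b :: a)).smpJ := by
      simp only [Model.born, Model.child, i4, i6]
    exact ⟨h1, h2, h3, hcut _ h1 h2 h3⟩

lemma Model.pos_congr_seed (hw : ∀ i, (w i).1 = (w' i).1 ∧ (isI N₀ i = false → w i = w' i))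
    (i : Input) : M.pos w e N₀ i = M.pos w' e N₀ i := by
  have : M.cellOf w e N₀ i = M.cellOf w' e N₀ i := by
    cases i with
    | first n => rfl
    | est a n => exact (M.born_congr_seed N₀ hw a).1
    | grow a n => exact (M.born_congr_seed N₀ hw a).1
  rw [Model.pos, Model.pos, this, (hw i).1]

lemma Model.tagI_congr_seed (hw : ∀ i, (w i).1 = (w' i).1 ∧ (isI N₀ i = false → w i = w' i))
    (a : List Bool) : M.tagI w e N₀ a = M.tagI w' e N₀ a := by
  induction a with
  | nil => rfl
  | cons b a ih =>
    simp only [Model.tagI, ih, (M.born_congr_seed N₀ hw a).2.2.2, M.pos_congr_seed N₀ hw]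

/-- The cut at a node uses only the coin of that node, so `born a` reads the coins of proper
ancestors only. The coin at `a` itself is still fresh when `a` is created. -/
lemma Model.born_congr_coin (a : List Bool) (he : ∀ b, b.length < a.length → e b = e' b) :
    M.born w e N₀ a = M.born w e' N₀ a := by
  induction a with
  | nil => rfl
  | cons b a ih =>
    have h1 := ih fun c hc => he c (hc.trans (Nat.lt_succ_self _))
    have h2 : M.cut e (M.full w (M.born w e N₀ a)) = M.cut e' (M.full w (M.born w e N₀ a)) := by
      simp only [Model.cut, Model.full_addr, Model.born_addr, he a (Nat.lt_succ_self _)]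
    simp only [Model.born, Model.child, h2]
    rw [h1]

lemma Model.pathTo_congr_coin (x : Pt d) (k : ℕ) (he : ∀ b, b.length < k → e b = e' b) :
    M.pathTo w e N₀ x k = M.pathTo w e' N₀ x k := by
  induction k with
  | zero => rfl
  | succ k ih =>
    have h1 := ih fun c hc => he c (hc.trans (Nat.lt_succ_self _))
    have h2 := M.born_congr_coin (w := w) N₀ (M.pathTo w e' N₀ x k) (e := e) (e' := e')
      fun b hb => he b (by rw [Model.length_pathTo] at hb; omega)
    have h3 : ∀ L : Node d, L.addr = M.pathTo w e' N₀ x k → M.cut e L = M.cut e' L := fun L hL => by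
      simp only [Model.cut, hL, he (M.pathTo w e' N₀ x k) (by simp)]
    rw [Model.pathTo, Model.pathTo, h1, h2, h3 _ (by simp)]

lemma cutCount_congr_coin (j : Fin d) (a : List Bool)
    (he : ∀ b, b.length < a.length → e b = e' b) : cutCount e j a = cutCount e' j a := by
  induction a with
  | nil => rfl
  | cons b a ih =>
    rw [cutCount, cutCount, he a (Nat.lt_succ_self _),
      ih fun c hc => he c (hc.trans (Nat.lt_succ_self _))]

end Honesty

/-! ### Deterministic consequences of small noise and small cells; counting by depth -/

section Deterministic

variable {d : ℕ} {V : Type*} (M : Model d V) (w : Input → (Fin d → ℝ) × V)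
  (e : List Bool → Bool × Fin d) (N₀ : ℕ)

/-- The names of the samples of `𝓢_𝓘` in a leaf after `k` visits. -/
def Model.leafTags (a : List Bool) (k : ℕ) : List Input :=
  M.tagI w e N₀ a ++ (List.range k).map (Input.est a)

/-- The total noise of the samples of `𝓢_𝓘` in a leaf after `k` visits. -/
def Model.noiseSum (m : Pt d → ℝ) (a : List Bool) (k : ℕ) : ℝ :=
  ((M.leafTags w e N₀ a k).map fun i => (M.samp w e N₀ i).2 - m (M.pos w e N₀ i)).sum

/-- A leaf after `k` visits has many samples, but their average noise is large. -/
def Model.NoiseBad (m : Pt d → ℝ) (η : ℝ) (a : List Bool) (k : ℕ) : Prop :=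
  M.β * M.f (a.length - 1) + k ≤ (M.leafTags w e N₀ a k).length ∧
  (∀ i ∈ M.leafTags w e N₀ a k, M.pos w e N₀ i ∈ cube d) ∧
  η * (M.leafTags w e N₀ a k).length ≤ |M.noiseSum w e N₀ m a k|

lemma Model.born_region_subset (a : List Bool) : (M.born w e N₀ a).cell.region ⊆ cube d := by
  induction a with
  | nil => exact subset_rfl
  | cons b a ih =>
    rw [Model.born, Model.child_cell, Model.full_cell]
    cases b <;> exact Set.inter_subset_left.trans ih

lemma Model.le_length_born (a : List Bool) (ha : a ≠ []) (h : (M.born w e N₀ a).valid) :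
    M.β * M.f (a.length - 1) ≤ (M.born w e N₀ a).smpI.length := by
  cases a with
  | nil => exact absurd rfl ha
  | cons b a =>
    have := M.le_length_child_smpI e h
    simpa [Model.born] using this

lemma Model.length_leafTags (a : List Bool) (k : ℕ) :
    (M.leafTags w e N₀ a k).length = (M.born w e N₀ a).smpI.length + k := by
  simp [Model.leafTags, (M.born_smp w e N₀ a).1]

/-- The sample mean is the average of `m` over positions in the cell plus the average noise. -/
lemma Model.mean_sub_le (hα : 0 < M.α) (hβ : 0 < M.β) (hf : ∀ c, 0 < M.f c)
    (hu : ∀ i j, 0 < (w i).1 j ∧ (w i).1 j ≤ 1) {m : Pt d → ℝ} {η : ℝ} {a : List Bool} (ha : a ≠ [])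
    (h : (M.born w e N₀ a).valid) {k : ℕ} (hn : ¬ M.NoiseBad w e N₀ m η a k) :
    (∀ B, (∀ x ∈ (M.born w e N₀ a).cell.region, m x ≤ B) →
      ((M.visit w)^[k] (M.born w e N₀ a)).mean ≤ B + η) ∧
    (∀ B, (∀ x ∈ (M.born w e N₀ a).cell.region, B ≤ m x) →
      B - η ≤ ((M.visit w)^[k] (M.born w e N₀ a)).mean) := by
  have hpos : ∀ i ∈ M.leafTags w e N₀ a k, M.pos w e N₀ i ∈ (M.born w e N₀ a).cell.region := by
    intro i hi
    refine M.smpI_mem_region_of_visit w e N₀ hα hu a h k (M.samp w e N₀ i) ?_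
    rw [Model.visit_smpI]
    exact List.mem_map_of_mem hi
  have hlen := M.le_length_born w e N₀ a ha h
  have hcard := M.length_leafTags w e N₀ a k
  have hn' : |M.noiseSum w e N₀ m a k| < η * (M.leafTags w e N₀ a k).length := by
    by_contra! hcon
    -- The first two clauses of `NoiseBad` hold automatically at a valid node, so its failure can
    -- only be that of the noise bound.
    refine hn ⟨?_, fun i hi => M.born_region_subset w e N₀ a (hpos i hi), hcon⟩
    rw [hcard]
    push_cast
    linarith
  have hl0 : (0 : ℝ) < (M.leafTags w e N₀ a k).length := by
    rw [hcard]
    push_cast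
    have : 0 < M.β * M.f (a.length - 1) := mul_pos hβ (by exact_mod_cast hf _)
    have : (0 : ℝ) ≤ k := k.cast_nonneg
    linarith
  have hmean : ((M.visit w)^[k] (M.born w e N₀ a)).mean * (M.leafTags w e N₀ a k).length =
      M.noiseSum w e N₀ m a k + ((M.leafTags w e N₀ a k).map fun i => m (M.pos w e N₀ i)).sum := by
    rw [Node.mean, avg, Model.visit_smpI, ← Model.leafTags, List.map_map, List.length_map,
      div_mul_cancel₀ _ hl0.ne', Model.noiseSum, ← List.sum_map_add]
    simp [Function.comp_def]
  rw [abs_lt] at hn'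
  constructor
  · intro B hB
    have h1 : ((M.leafTags w e N₀ a k).map fun i => m (M.pos w e N₀ i)).sum ≤
        (M.leafTags w e N₀ a k).length * B := by
      have := List.sum_le_card_nsmul ((M.leafTags w e N₀ a k).map fun i => m (M.pos w e N₀ i)) B
        (by
          intro y hy
          obtain ⟨i, hi, rfl⟩ := List.mem_map.1 hy
          exact hB _ (hpos i hi))
      simpa using this
    refine le_of_mul_le_mul_right ?_ hl0
    rw [hmean]
    linarith
  · intro B hB
    have h1 : (M.leafTags w e N₀ a k).length * B ≤
        ((M.leafTags w e N₀ a k).map fun i => m (M.pos w e N₀ i)).sum := by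
      have := List.card_nsmul_le_sum ((M.leafTags w e N₀ a k).map fun i => m (M.pos w e N₀ i)) B
        (by
          intro y hy
          obtain ⟨i, hi, rfl⟩ := List.mem_map.1 hy
          exact hB _ (hpos i hi))
      simpa using this
    refine le_of_mul_le_mul_right ?_ hl0
    rw [hmean]
    linarith

/-- The Euclidean norm is at most the sum of the absolute coordinates; the crude factor `d` in place
of `√d` is harmless, as `r` will decay geometrically. -/
lemma norm_le_of_abs_le {x : Pt d} {r : ℝ} (h : ∀ i, |x i| ≤ r) : ‖x‖ ≤ d * r := by
  rw [EuclideanSpace.norm_eq]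
  refine Real.sqrt_le_iff.2 ⟨?_, ?_⟩
  · rcases Nat.eq_zero_or_pos d with rfl | hd
    · simp
    · exact mul_nonneg (Nat.cast_nonneg _) ((abs_nonneg _).trans (h ⟨0, hd⟩))
  · calc ∑ i, ‖x i‖ ^ 2 ≤ (∑ i, ‖x i‖) ^ 2 :=
        Finset.sum_sq_le_sq_sum_of_nonneg fun i _ => norm_nonneg _
      _ ≤ (d * r) ^ 2 := by
        refine pow_le_pow_left₀ (Finset.sum_nonneg fun i _ => norm_nonneg _) ?_ 2
        calc ∑ i, ‖x i‖ ≤ ∑ _i : Fin d, r := Finset.sum_le_sum fun i _ => h i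
          _ = d * r := by simp

/-- If the noise averages of all leaves are small and the leaf of the maximizer is small, then the
best leaf is close to the maximizer. -/
lemma Model.infDist_lt_of_not_bad (hα : 0 < M.α) (hα' : M.α ≤ 1 / 2) (hβ : 0 < M.β)
    (hf : ∀ c, 0 < M.f c) (hu : ∀ i j, 0 < (w i).1 j ∧ (w i).1 j ≤ 1) {m : Pt d → ℝ} {xs : Pt d}
    (hxs : xs ∈ cube d) {C δ ε : ℝ} (hC : 0 < C) (hδ : 0 < δ)
    (hlip : ∀ x ∈ cube d, m xs - m x ≤ C * ‖x - xs‖)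
    (hgap : ∀ x ∈ cube d, ε ≤ ‖x - xs‖ → m x < m xs - δ)
    {S : State d} (hS : M.Sound w e N₀ S) (hv : S.Valid) {h t : ℕ} (hh : 0 < h)
    (hdepth : ∀ L ∈ S.leaves, h ≤ L.depth)
    (hnoise : ∀ L ∈ S.leaves, ∀ k, ¬ M.NoiseBad w e N₀ m (δ / 4) L.addr k)
    (hcount : ∀ j, t ≤ cutCount e j (M.pathTo w e N₀ xs h))
    (ht : C * (d * (1 - M.α) ^ t) ≤ δ / 4) {L : Node d} (hL : S.IsBest L) :
    Metric.infDist xs L.cell.region < ε := by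
  by_contra! hcon
  have hreach := hS.reached hv
  have hne : ∀ A ∈ S.leaves, A.addr ≠ [] := fun A hA h0 => by
    have := hdepth A hA
    rw [Node.depth, h0] at this
    simp at this
    omega
  have hborn : ∀ A ∈ S.leaves, (M.born w e N₀ A.addr).valid ∧
      (M.born w e N₀ A.addr).cell = A.cell := fun A hA => by
    obtain ⟨⟨k, hk⟩, -⟩ := hreach A hA
    have h1 := hv A hA
    constructor
    · rw [hk] at h1
      simpa using h1
    · conv_rhs => rw [hk]
      simp
  have hest : ∀ A ∈ S.leaves, (∀ B, (∀ x ∈ A.cell.region, m x ≤ B) → A.mean ≤ B + δ / 4) ∧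
      (∀ B, (∀ x ∈ A.cell.region, B ≤ m x) → B - δ / 4 ≤ A.mean) := fun A hA => by
    obtain ⟨⟨k, hk⟩, -⟩ := hreach A hA
    obtain ⟨h1, h2⟩ := hborn A hA
    have := M.mean_sub_le w e N₀ hα hβ hf hu (hne A hA) h1 (hnoise A hA k)
    rw [← hk, h2] at this
    exact this
  have hsub : ∀ A ∈ S.leaves, A.cell.region ⊆ cube d := fun A hA => by
    rw [← (hborn A hA).2]
    exact M.born_region_subset w e N₀ _
  obtain ⟨A, hA, hxA⟩ := hS.isTree.cover xs hxs
  -- Separation against noise: the far leaf stays below `m xs - 3δ/4`, while the leaf `A` of the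
  -- maximizer stays above `m xs - δ/2`, losing `δ/4` to its extent and `δ/4` to noise.
  have h1 : L.mean ≤ m xs - δ + δ / 4 := by
    refine (hest L hL.1).1 _ fun x hx => (hgap x (hsub L hL.1 hx) ?_).le
    rw [← dist_eq_norm, dist_comm]
    exact hcon.trans (Metric.infDist_le_dist_of_mem hx)
  have h2 : m xs - δ / 4 - δ / 4 ≤ A.mean := by
    refine (hest A hA).2 _ fun x hx => ?_
    obtain ⟨hAv, hAc⟩ := hborn A hA
    have hprop := M.born_proper w e N₀ hα _ hAv
    have hside : ∀ j, |(x - xs) j| ≤ (1 - M.α) ^ t := fun j => by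
      have h3 := M.side_le w e N₀ hα hα' _ hAv j
      have h4 : t ≤ cutCount e j A.addr := by
        -- `A` lies on the branch to `xs` at depth at least `h`, and the count of forced cuts only
        -- grows along the branch.
        rw [M.eq_pathTo w e N₀ (x := xs) A.addr (by rwa [hAc])]
        exact (hcount j).trans (M.cutCount_pathTo_mono w e N₀ xs j (hdepth A hA))
      have h5 : (1 - M.α) ^ cutCount e j A.addr ≤ (1 - M.α) ^ t :=
        pow_le_pow_of_le_one (by linarith) (by linarith) h4
      have h6 := hprop.region_subset x (by rwa [hAc]) j
      have h7 := hprop.region_subset xs (by rwa [hAc]) j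
      rw [PiLp.sub_apply, abs_le]
      constructor <;> linarith
    have h8 := norm_le_of_abs_le hside
    have h9 := hlip x (hsub A hA hx)
    have h10 := mul_le_mul_of_nonneg_left h8 hC.le
    linarith
  have h3 := hL.2 A hA
  linarith

lemma State.two_pow_le_length {S : State d} (hS : S.IsTree) {c : ℕ}
    (h : ∀ L ∈ S.leaves, c ≤ L.depth) : 2 ^ c ≤ S.leaves.length := by
  have h1 : (1 : ℝ) ≤ S.leaves.length * (1 / 2) ^ c := by
    have := List.sum_le_card_nsmul (S.leaves.map fun L => (1 / 2 : ℝ) ^ L.depth) ((1 / 2) ^ c)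
      (by
        intro y hy
        obtain ⟨L, hL, rfl⟩ := List.mem_map.1 hy
        exact pow_le_pow_of_le_one (by norm_num) (by norm_num) (h L hL))
    rw [hS.kraft] at this
    simpa using this
  rw [one_div, inv_pow, ← div_eq_mul_inv, one_le_div (by positivity)] at h1
  exact_mod_cast h1

lemma State.length_le_two_pow {S : State d} (hS : S.IsTree) {c : ℕ}
    (h : ∀ L ∈ S.leaves, L.depth ≤ c) : S.leaves.length ≤ 2 ^ c := by
  have h1 : S.leaves.length * (1 / 2) ^ c ≤ (1 : ℝ) := by
    have := List.card_nsmul_le_sum (S.leaves.map fun L => (1 / 2 : ℝ) ^ L.depth) ((1 / 2) ^ c)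
      (by
        intro y hy
        obtain ⟨L, hL, rfl⟩ := List.mem_map.1 hy
        exact pow_le_pow_of_le_one (by norm_num) (by norm_num) (h L hL))
    rw [hS.kraft] at this
    simpa using this
  rw [one_div, inv_pow, ← div_eq_mul_inv, div_le_one (by positivity)] at h1
  exact_mod_cast h1

/-- A deep tree contains many samples. -/
lemma Model.le_sizeI (hβ : 0 < M.β) (hmono : Monotone M.f) {S : State d}
    (hS : M.Sound w e N₀ S) (hv : S.Valid) {c : ℕ} (hc : 0 < c)
    (h : ∀ L ∈ S.leaves, c ≤ L.depth) : 2 ^ c * (M.β * M.f (c - 1)) ≤ S.sizeI := by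
  have h1 : (2 ^ c : ℝ) ≤ S.leaves.length := by
    exact_mod_cast State.two_pow_le_length hS.isTree h
  have h2 : S.leaves.length * (M.β * M.f (c - 1)) ≤ (S.sizeI : ℝ) := by
    have := List.card_nsmul_le_sum (S.leaves.map fun L => (L.smpI.length : ℝ)) (M.β * M.f (c - 1))
      (by
        intro y hy
        obtain ⟨L, hL, rfl⟩ := List.mem_map.1 hy
        obtain ⟨⟨k, hk⟩, -⟩ := hS.reached hv L hL
        have hvL := hv L hL
        rw [hk] at hvL
        have hd := h L hL
        have h3 := M.le_length_born w e N₀ L.addr (by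
          intro h0
          rw [Node.depth, h0] at hd
          simp at hd
          omega) (by simpa using hvL)
        have h4 : (M.born w e N₀ L.addr).smpI.length ≤ L.smpI.length := by
          conv_rhs => rw [hk, Model.visit_iterate_smpI]
          simp
        have h5 : M.f (c - 1) ≤ M.f (L.addr.length - 1) := hmono (Nat.sub_le_sub_right hd 1)
        have h6 : M.β * M.f (c - 1) ≤ M.β * M.f (L.addr.length - 1) :=
          mul_le_mul_of_nonneg_left (by exact_mod_cast h5) hβ.le
        exact h6.trans (h3.trans (by exact_mod_cast h4)))
    have h7 : (S.sizeI : ℝ) = (S.leaves.map fun L => (L.smpI.length : ℝ)).sum := by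
      rw [State.sizeI, Nat.cast_list_sum, List.map_map]
      rfl
    rw [h7]
    simpa using this
  refine le_trans ?_ h2
  exact mul_le_mul_of_nonneg_right h1 (by positivity)

/-- A shallow tree uses few simulations. -/
lemma Model.n_le (hmono : Monotone M.f) {S : State d} (hS : M.Sound w e N₀ S) (hv : S.Valid)
    {c : ℕ} (h : ∀ L ∈ S.leaves, L.depth ≤ c) : S.n ≤ 3 * (2 ^ c * M.f c) + 1 := by
  have h1 := State.length_le_two_pow hS.isTree h
  have h2 := hS.countBound c h
  -- A current leaf of an executable run holds fewer samples than its threshold, by `Reached`.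
  have h3 : S.sizeI ≤ S.leaves.length * M.f c := by
    have := List.sum_le_card_nsmul (S.leaves.map fun L => L.smpI.length) (M.f c)
      (by
        intro y hy
        obtain ⟨L, hL, rfl⟩ := List.mem_map.1 hy
        exact ((hS.reached hv L hL).2.trans_le (hmono (h L hL))).le)
    simpa [State.sizeI] using this
  have h4 := Nat.mul_le_mul_right (M.f c) h1
  omega

end Deterministic

/-! ### Measurability of the strategy-independent tree -/

section Measurability

instance : MeasurableSpace Input := ⊤
instance : MeasurableSpace (List Input) := ⊤
instance : MeasurableSpace (List Bool) := ⊤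
instance : MeasurableSingletonClass Input := ⟨fun _ => trivial⟩
instance : MeasurableSingletonClass (List Input) := ⟨fun _ => trivial⟩
instance : MeasurableSingletonClass (List Bool) := ⟨fun _ => trivial⟩

instance : Countable Input := by
  let g : Input → ℕ ⊕ (List Bool × ℕ) ⊕ (List Bool × ℕ) := fun i =>
    match i with
    | .first n => .inl n
    | .est a n => .inr (.inl (a, n))
    | .grow a n => .inr (.inr (a, n))
  have hg : Function.Injective g := by
    intro i j h
    cases i <;> cases j <;> simp_all [g]
  exact hg.countable

variable {Θ γ κ : Type*} [MeasurableSpace Θ] [MeasurableSpace γ]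

lemma measurable_apply_of_countable [Countable κ] [MeasurableSpace κ] [MeasurableSingletonClass κ]
    {T : Θ → κ} (hT : Measurable T) {F : κ → Θ → γ} (hF : ∀ k, Measurable (F k)) :
    Measurable fun θ => F (T θ) θ := by
  have : Measurable fun p : κ × Θ => F p.1 p.2 := measurable_from_prod_countable_right hF
  exact this.comp (hT.prodMk measurable_id)

/-- Lists of names take countably many values and can be frozen one at a time. The predicate `G`
discards values that never occur: inside an induction on the depth, measurability is known only for
names of levels already treated. -/
lemma measurable_apply_of_countable_of_mem [Countable κ] [MeasurableSpace κ]
    [MeasurableSingletonClass κ] [Nonempty γ] {T : Θ → κ} (hT : Measurable T) {F : κ → Θ → γ}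
    (G : κ → Prop) (hG : ∀ θ, G (T θ)) (hF : ∀ k, G k → Measurable (F k)) :
    Measurable fun θ => F (T θ) θ := by
  classical
  have := measurable_apply_of_countable hT
    (F := fun k => if G k then F k else fun _ => Classical.arbitrary γ) (fun k => by
      split_ifs with h
      · exact hF k h
      · exact measurable_const)
  simpa [hG] using this

lemma ofFn_comp_get {α β : Type*} (l : List α) (g : α → β) :
    List.ofFn (fun i => g (l.get i)) = l.map g := by
  rw [← Function.comp_def, ← List.map_ofFn, List.ofFn_get]

lemma measurable_filter (l : List Input) {p : Input → Θ → Bool} (hp : ∀ i ∈ l, Measurable (p i)) :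
    Measurable fun θ => l.filter fun i => p i θ := by
  induction l with
  | nil => exact measurable_const
  | cons x l ih =>
    simp only [List.filter_cons]
    have h1 := ih fun i hi => hp i (List.mem_cons_of_mem _ hi)
    refine Measurable.ite (hp x List.mem_cons_self (measurableSet_singleton true)) ?_ h1
    exact (measurable_from_top (f := fun l => x :: l)).comp h1

/-- The depth of the node from which a sample is drawn. -/
def Input.level : Input → ℕ
  | .first _ => 0
  | .est a _ => a.length
  | .grow a _ => a.length

lemma Model.level_le_of_mem_extendI {d : ℕ} {V : Type*} (M : Model d V) (N₀ : ℕ) {w : Input → (Fin d → ℝ) × V} 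
    {e : List Bool → Bool × Fin d} {a : List Bool} {i : Input} (hi : i ∈ M.extendI a (M.tagI w e N₀ a)) : i.level ≤ a.length := by
  rcases List.mem_append.1 hi with h | h
  · rcases M.tagI_level w e N₀ a i h with ⟨n, -, rfl⟩ | ⟨b, n, h1, rfl⟩
    · exact Nat.zero_le _
    · exact h1.le
  · obtain ⟨n, -, rfl⟩ := List.mem_map.1 h
    exact le_rfl

lemma Model.level_le_of_mem_extendJ {d : ℕ} {V : Type*} (M : Model d V) (N₀ : ℕ) {w : Input → (Fin d → ℝ) × V} 
    {e : List Bool → Bool × Fin d} {a : List Bool} {l : List Input} {i : Input} (hi : i ∈ M.extendJ a l (M.tagJ w e N₀ a)) :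
    i.level ≤ a.length := by
  rcases List.mem_append.1 hi with h | h
  · rcases M.tagJ_level w e N₀ a i h with ⟨n, -, rfl⟩ | ⟨b, n, h1, rfl⟩
    · exact Nat.zero_le _
    · exact h1.le
  · obtain ⟨n, -, rfl⟩ := List.mem_map.1 h
    exact le_rfl

variable {d : ℕ} {V : Type*} [MeasurableSpace V] (M : Model d V) (N₀ : ℕ)

/-- All the random inputs of a run. -/
abbrev Inputs (d : ℕ) (V : Type*) :=
  (Input → (Fin d → ℝ) × V) × (List Bool → Bool × Fin d)

lemma measurable_cell_place {lo hi u : Θ → Fin d → ℝ} (hlo : Measurable lo) (hhi : Measurable hi)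
    (hu : Measurable u) (R : Θ → Set (Pt d)) :
    Measurable fun θ => (Cell.mk (lo θ) (hi θ) (R θ)).place (u θ) := by
  refine (WithLp.measurable_toLp 2 _).comp (measurable_pi_lambda _ fun i => ?_)
  have h1 := (measurable_pi_apply i).comp hlo
  have h2 := (measurable_pi_apply i).comp hhi
  have h3 := (measurable_pi_apply i).comp hu
  exact h1.add (h3.mul (h2.sub h1))

/-- A node whose box and whose lists of names depend measurably on the random inputs. -/
structure Model.MeasurableNode (a : List Bool) : Prop where
  lo : Measurable fun θ : Inputs d V => (M.born θ.1 θ.2 N₀ a).cell.lo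
  hi : Measurable fun θ : Inputs d V => (M.born θ.1 θ.2 N₀ a).cell.hi
  tagI : Measurable fun θ : Inputs d V => M.tagI θ.1 θ.2 N₀ a
  tagJ : Measurable fun θ : Inputs d V => M.tagJ θ.1 θ.2 N₀ a

lemma Model.measurable_pos_of_level {n : ℕ}
    (h : ∀ a : List Bool, a.length ≤ n → M.MeasurableNode N₀ a) {i : Input} (hi : i.level ≤ n) :
    Measurable fun θ : Inputs d V => M.pos θ.1 θ.2 N₀ i := by
  have hw : ∀ i : Input, Measurable fun θ : Inputs d V => (θ.1 i).1 := fun i => by fun_prop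
  cases i with
  | first k => exact measurable_cell_place measurable_const measurable_const (hw _) fun _ => cube d
  | est a k => exact measurable_cell_place (h a hi).lo (h a hi).hi (hw _) _
  | grow a k => exact measurable_cell_place (h a hi).lo (h a hi).hi (hw _) _

lemma Model.measurable_samp_of_pos (hsim : Measurable (Function.uncurry M.sim)) {i : Input}
    (h : Measurable fun θ : Inputs d V => M.pos θ.1 θ.2 N₀ i) :
    Measurable fun θ : Inputs d V => M.samp θ.1 θ.2 N₀ i := by
  have hw : Measurable fun θ : Inputs d V => (θ.1 i).2 := by fun_prop
  exact h.prodMk (hsim.comp (h.prodMk hw))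

/-- Once the lists of names are frozen, the numbers of samples are constants, which is the setting
in which the selector is assumed measurable. -/
lemma Model.measurable_cutAt_of_level [Nonempty (Fin d)]
    (hsim : Measurable (Function.uncurry M.sim)) (hsel : M.sel.IsMeasurable) {a : List Bool}
    (h : ∀ b : List Bool, b.length ≤ a.length → M.MeasurableNode N₀ b) :
    Measurable fun θ : Inputs d V => M.cutAt θ.1 θ.2 N₀ a := by
  have hpos := fun i hi => M.measurable_pos_of_level N₀ h (i := i) hi
  have hsamp := fun i hi => M.measurable_samp_of_pos N₀ hsim (hpos i hi)
  have ha := h a le_rfl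
  have hT : Measurable fun θ : Inputs d V => (M.tagI θ.1 θ.2 N₀ a, M.tagJ θ.1 θ.2 N₀ a) :=
    ha.tagI.prodMk ha.tagJ
  have key : ∀ (g : SplitData d → Fin d × ℝ),
      (∀ thr n m, Measurable fun p => g (SplitData.ofTuples thr n m p)) →
      Measurable fun θ : Inputs d V => g (M.splitData (M.full θ.1 (M.born θ.1 θ.2 N₀ a))) := by
    intro g hg
    simp only [Model.splitData_full]
    refine measurable_apply_of_countable_of_mem hT (γ := Fin d × ℝ)
      (F := fun (t : List Input × List Input) (θ : Inputs d V) =>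
        g ⟨M.f a.length, (M.born θ.1 θ.2 N₀ a).cell.lo, (M.born θ.1 θ.2 N₀ a).cell.hi,
          (M.extendI a t.1).map (M.pos θ.1 θ.2 N₀),
          (M.extendJ a t.1 t.2).map (M.samp θ.1 θ.2 N₀)⟩)
      (fun t => (∀ i ∈ M.extendI a t.1, i.level ≤ a.length) ∧
        ∀ i ∈ M.extendJ a t.1 t.2, i.level ≤ a.length)
      (fun θ => ⟨fun i => M.level_le_of_mem_extendI N₀, fun i => M.level_le_of_mem_extendJ N₀⟩) ?_
    rintro ⟨l, l'⟩ ⟨h1, h2⟩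
    dsimp only at h1 h2 ⊢
    generalize M.extendJ a l l' = t' at h2 ⊢
    generalize M.extendI a l = t at h1 ⊢
    have hm : Measurable fun θ : Inputs d V =>
        (((M.born θ.1 θ.2 N₀ a).cell.lo, (M.born θ.1 θ.2 N₀ a).cell.hi),
          (fun i : Fin t.length => M.pos θ.1 θ.2 N₀ (t.get i)),
          (fun i : Fin t'.length => M.samp θ.1 θ.2 N₀ (t'.get i))) := by
      refine (ha.lo.prodMk ha.hi).prodMk (Measurable.prodMk ?_ ?_)
      · exact measurable_pi_lambda _ fun i => hpos _ (h1 _ (List.get_mem _ _))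
      · exact measurable_pi_lambda _ fun i => hsamp _ (h2 _ (List.get_mem _ _))
    have := (hg (M.f a.length) t.length t'.length).comp hm
    refine (congrArg Measurable (funext fun θ => ?_)).mp this
    simp only [Function.comp_apply, SplitData.ofTuples]
    rw [ofFn_comp_get, ofFn_comp_get]
  have he : Measurable fun θ : Inputs d V => θ.2 a := by fun_prop
  unfold Model.cutAt Model.cut
  simp only [Model.full_addr, Model.born_addr]
  refine Measurable.ite (he.fst (measurableSet_singleton true)) ?_ ?_
  · refine measurable_apply_of_countable he.snd (F := fun j (θ : Inputs d V) =>
      (j, M.sel.along (M.splitData (M.full θ.1 (M.born θ.1 θ.2 N₀ a))) j)) fun j => ?_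
    exact key (fun D => (j, M.sel.along D j)) fun thr n m =>
      measurable_const.prodMk ((hsel thr n m).1 j)
  · exact key M.sel.free fun thr n m => (hsel thr n m).2

lemma measurable_keepSide {c : Θ → Fin d × ℝ} {x : Θ → Pt d} (hc : Measurable c)
    (hx : Measurable x) (b : Bool) : Measurable fun θ => keepSide (c θ) b (x θ) := by
  have h1 : Measurable fun θ => x θ (c θ).1 :=
    measurable_apply_of_countable hc.fst (F := fun j θ => x θ j) fun j =>
      (measurable_pi_apply j).comp ((WithLp.measurable_ofLp 2 _).comp hx)
  have h2 : Measurable fun θ => (c θ).2 := hc.snd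
  cases b
  · simp only [keepSide, Bool.false_eq_true, if_false]
    refine measurable_to_bool ?_
    simpa [Set.preimage] using measurableSet_le h1 h2
  · simp only [keepSide, if_true]
    refine measurable_to_bool ?_
    simpa [Set.preimage] using measurableSet_lt h2 h1

lemma measurable_update_cell {z : Θ → ℝ} {j : Θ → Fin d} {lo : Θ → Fin d → ℝ}
    (hlo : Measurable lo) (hj : Measurable j) (hz : Measurable z) :
    Measurable fun θ => Function.update (lo θ) (j θ) (z θ) := by
  refine measurable_pi_lambda _ fun i => ?_
  simp only [Function.update_apply]
  refine Measurable.ite ?_ hz ((measurable_pi_apply i).comp hlo)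
  have : {θ | i = j θ} = j ⁻¹' {i} := by ext θ; simp [eq_comm]
  rw [this]
  exact hj (measurableSet_singleton i)

/-- The induction runs over all addresses of bounded length rather than along one branch, because a
frozen list of names is only known to have bounded levels, not to come from ancestors of `a`. -/
lemma Model.measurableNode [Nonempty (Fin d)] (hsim : Measurable (Function.uncurry M.sim))
    (hsel : M.sel.IsMeasurable) (a : List Bool) : M.MeasurableNode N₀ a := by
  suffices H : ∀ n, ∀ a : List Bool, a.length ≤ n → M.MeasurableNode N₀ a from H _ a le_rfl
  have hnil : M.MeasurableNode N₀ [] :=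
    ⟨measurable_const, measurable_const, measurable_const, measurable_const⟩
  intro n
  induction n with
  | zero =>
    intro a ha
    rw [List.length_eq_zero_iff.1 (Nat.le_zero.1 ha)]
    exact hnil
  | succ n ih =>
    intro a ha
    cases a with
    | nil => exact hnil
    | cons b a =>
      have h : ∀ c : List Bool, c.length ≤ a.length → M.MeasurableNode N₀ c := fun c hc =>
        ih c (hc.trans (Nat.le_of_succ_le_succ ha))
      have hpos := fun i hi => M.measurable_pos_of_level N₀ h (i := i) hi
      have hcut := M.measurable_cutAt_of_level N₀ hsim hsel h
      have ha' := h a le_rfl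
      have hT : Measurable fun θ : Inputs d V => (M.tagI θ.1 θ.2 N₀ a, M.tagJ θ.1 θ.2 N₀ a) :=
        ha'.tagI.prodMk ha'.tagJ
      refine ⟨?_, ?_, ?_, ?_⟩
      · simp only [Model.born, Model.child_cell, Model.full_cell]
        cases b
        · exact ha'.lo
        · exact measurable_update_cell ha'.lo hcut.fst hcut.snd
      · simp only [Model.born, Model.child_cell, Model.full_cell]
        cases b
        · exact measurable_update_cell ha'.hi hcut.fst hcut.snd
        · exact ha'.hi
      · exact measurable_apply_of_countable_of_mem ha'.tagI
          (F := fun (t : List Input) (θ : Inputs d V) => (M.extendI a t).filter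
            fun i => keepSide (M.cutAt θ.1 θ.2 N₀ a) b (M.pos θ.1 θ.2 N₀ i))
          (fun t => ∀ i ∈ M.extendI a t, i.level ≤ a.length)
          (fun θ i => M.level_le_of_mem_extendI N₀)
          fun t ht => measurable_filter _ fun i hi =>
            measurable_keepSide hcut (hpos i (ht i hi)) b
      · exact measurable_apply_of_countable_of_mem hT
          (F := fun (t : List Input × List Input) (θ : Inputs d V) => (M.extendJ a t.1 t.2).filter
            fun i => keepSide (M.cutAt θ.1 θ.2 N₀ a) b (M.pos θ.1 θ.2 N₀ i))
          (fun t => ∀ i ∈ M.extendJ a t.1 t.2, i.level ≤ a.length)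
          (fun θ i => M.level_le_of_mem_extendJ N₀)
          fun t ht => measurable_filter _ fun i hi =>
            measurable_keepSide hcut (hpos i (ht i hi)) b

lemma Model.measurable_pos [Nonempty (Fin d)] (hsim : Measurable (Function.uncurry M.sim))
    (hsel : M.sel.IsMeasurable) (i : Input) :
    Measurable fun θ : Inputs d V => M.pos θ.1 θ.2 N₀ i :=
  M.measurable_pos_of_level N₀ (fun a _ => M.measurableNode N₀ hsim hsel a) (le_refl i.level)

lemma Model.measurable_cutAt [Nonempty (Fin d)] (hsim : Measurable (Function.uncurry M.sim))
    (hsel : M.sel.IsMeasurable) (a : List Bool) :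
    Measurable fun θ : Inputs d V => M.cutAt θ.1 θ.2 N₀ a :=
  M.measurable_cutAt_of_level N₀ hsim hsel fun b _ => M.measurableNode N₀ hsim hsel b

lemma Model.measurable_pathTo [Nonempty (Fin d)] (hsim : Measurable (Function.uncurry M.sim))
    (hsel : M.sel.IsMeasurable) (x : Pt d) (k : ℕ) :
    Measurable fun θ : Inputs d V => M.pathTo θ.1 θ.2 N₀ x k := by
  induction k with
  | zero => exact measurable_const
  | succ k ih =>
    refine measurable_apply_of_countable ih (F := fun a (θ : Inputs d V) =>
      keepSide (M.cutAt θ.1 θ.2 N₀ a) true x :: a) fun a => ?_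
    exact (measurable_from_top (f := fun b => b :: a)).comp
      (measurable_keepSide (M.measurable_cutAt N₀ hsim hsel a) measurable_const true)

lemma Model.measurableSet_noiseBad [Nonempty (Fin d)] (hsim : Measurable (Function.uncurry M.sim))
    (hsel : M.sel.IsMeasurable) {m : Pt d → ℝ} (hm : Measurable m) (η : ℝ) (a : List Bool)
    (k : ℕ) : MeasurableSet {θ : Inputs d V | M.NoiseBad θ.1 θ.2 N₀ m η a k} := by
  have hcube : MeasurableSet (cube d) := by
    have : cube d = ⋂ i, (fun x : Pt d => x i) ⁻¹' Set.Icc 0 1 := by ext x; simp [cube]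
    rw [this]
    exact MeasurableSet.iInter fun i =>
      ((measurable_pi_apply i).comp (WithLp.measurable_ofLp 2 _)) measurableSet_Icc
  have hpos := M.measurable_pos N₀ hsim hsel
  have hsamp := fun i => M.measurable_samp_of_pos N₀ hsim (hpos i)
  have h : Measurable fun θ : Inputs d V => M.NoiseBad θ.1 θ.2 N₀ m η a k := by
    refine measurable_apply_of_countable (M.measurableNode N₀ hsim hsel a).tagI
      (F := fun t (θ : Inputs d V) =>
        M.β * M.f (a.length - 1) + k ≤ ((t ++ (List.range k).map (Input.est a)).length : ℝ) ∧
        (∀ i ∈ t ++ (List.range k).map (Input.est a), M.pos θ.1 θ.2 N₀ i ∈ cube d) ∧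
        η * (t ++ (List.range k).map (Input.est a)).length ≤
          |((t ++ (List.range k).map (Input.est a)).map
            fun i => (M.samp θ.1 θ.2 N₀ i).2 - m (M.pos θ.1 θ.2 N₀ i)).sum|) fun t => ?_
    refine Measurable.and measurable_const (Measurable.and ?_ ?_)
    · generalize t ++ (List.range k).map (Input.est a) = s
      induction s with
      | nil => simp
      | cons x s ih =>
        simp only [List.forall_mem_cons]
        exact Measurable.and (measurableSet_setOfPred.1 (hpos x hcube)) ih
    · refine measurableSet_setOfPred.1 (measurableSet_le measurable_const (Measurable.abs ?_))
      generalize t ++ (List.range k).map (Input.est a) = s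
      induction s with
      | nil => simp
      | cons x s ih =>
        simp only [List.map_cons, List.sum_cons]
        exact ((hsamp x).snd.sub (hm.comp (hpos x))).add ih
  exact measurableSet_setOfPred.2 h

lemma Model.measurable_cutCount_pathTo [Nonempty (Fin d)] (hsim : Measurable (Function.uncurry M.sim))
    (hsel : M.sel.IsMeasurable) (x : Pt d) (k : ℕ) (j : Fin d) :
    Measurable fun θ : Inputs d V => cutCount θ.2 j (M.pathTo θ.1 θ.2 N₀ x k) := by
  refine measurable_apply_of_countable (M.measurable_pathTo N₀ hsim hsel x k)
    (F := fun a (θ : Inputs d V) => cutCount θ.2 j a) fun a => ?_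
  induction a with
  | nil => exact measurable_const
  | cons b a ih =>
    simp only [cutCount]
    have he : Measurable fun θ : Inputs d V => θ.2 a := by fun_prop
    exact (Measurable.ite (he (measurableSet_singleton (true, j))) measurable_const
      measurable_const).add ih

end Measurability

/-! ### Conditioning and independence tools -/

section Independence

variable {Ω : Type*} [mΩ : MeasurableSpace Ω] {P : Measure Ω}

/-- Fubini for the product law of `(X, Y)`. This is how one independent block of the randomness is
frozen while the other is estimated. -/
lemma measure_le_of_sections [IsProbabilityMeasure P] {α β : Type*} [MeasurableSpace α]
    [MeasurableSpace β] {X : Ω → α} {Y : Ω → β} (hX : Measurable X) (hY : Measurable Y)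
    (hXY : IndepFun X Y P) {A : Set (α × β)} (hA : MeasurableSet A) {c : ℝ≥0∞}
    (h : ∀ x, P {ω | (x, Y ω) ∈ A} ≤ c) : P {ω | (X ω, Y ω) ∈ A} ≤ c := by
  have h1 := (indepFun_iff_map_prod_eq_prod_map_map hX.aemeasurable hY.aemeasurable).1 hXY
  have := Measure.isProbabilityMeasure_map (μ := P) hX.aemeasurable
  have := Measure.isProbabilityMeasure_map (μ := P) hY.aemeasurable
  have h2 : P {ω | (X ω, Y ω) ∈ A} = (P.map X).prod (P.map Y) A := by
    rw [← h1, Measure.map_apply (hX.prodMk hY) hA]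
    rfl
  rw [h2, Measure.prod_apply hA]
  calc ∫⁻ x, P.map Y (Prod.mk x ⁻¹' A) ∂P.map X ≤ ∫⁻ _, c ∂P.map X := by
        refine lintegral_mono fun x => ?_
        rw [Measure.map_apply hY (measurable_prodMk_left hA)]
        exact h x
    _ = c := by simp

lemma indepFun_of_iIndepFun_of_disjoint {ι : Type*} {β : ι → Type*} {m : ∀ i, MeasurableSpace (β i)}
    {X : ∀ i, Ω → β i} (h : iIndepFun X P) (hX : ∀ i, Measurable (X i)) {S T : Set ι}
    (hST : Disjoint S T) :
    IndepFun (fun ω (i : S) => X i ω) (fun ω (i : T) => X i ω) P := by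
  have h1 := indep_iSup_of_disjoint (fun i => (hX i).comap_le) h.iIndep hST
  have h2 : ∀ S : Set ι, MeasurableSpace.comap (fun ω (i : S) => X i ω) inferInstance ≤
      ⨆ i ∈ S, MeasurableSpace.comap (X i) (m i) := fun S => by
    refine measurable_iff_comap_le.1 ?_
    refine @measurable_pi_lambda _ _ _ (_) _ _ fun i => ?_
    refine measurable_iff_comap_le.2 ?_
    exact le_iSup₂_of_le i.1 i.2 le_rfl
  exact indep_of_indep_of_le h1 (h2 S) (h2 T)

lemma iIndepFun_bool [IsProbabilityMeasure P] {β : Type*} [MeasurableSpace β] {X : Bool → Ω → β}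
    (h : IndepFun (X false) (X true) P) : iIndepFun X P := by
  rw [iIndepFun_iff_measure_inter_preimage_eq_mul]
  intro S sets hS
  have hcases : S = ∅ ∨ S = {false} ∨ S = {true} ∨ S = {false, true} := by
    clear hS
    revert S
    decide
  rcases hcases with rfl | rfl | rfl | rfl
  · simp
  · simp
  · simp
  · rw [Finset.prod_pair Bool.false_ne_true]
    have := indepFun_iff_measure_inter_preimage_eq_mul.1 h (sets false) (sets true)
      (hS _ (by simp)) (hS _ (by simp))
    rw [← this]
    congr 1
    ext ω
    simp

end Independence

/-! ### Splitting the random inputs into the seeds for `𝓢_𝓘` and everything else -/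

section Source

variable {d : ℕ} {V Ω : Type*} [MeasurableSpace V] [MeasurableSpace Ω] {P : Measure Ω}
  [IsProbabilityMeasure P] {Q : Measure V} [IsProbabilityMeasure Q] {κ : ℝ}
  {draw : Input → Ω → (Fin d → ℝ) × V} {coin : List Bool → Ω → Bool × Fin d}

instance isProbabilityMeasure_restrict_cube :
    IsProbabilityMeasure ((volume : Measure (Fin d → ℝ)).restrict (Set.Icc 0 1)) :=
  ⟨by rw [Measure.restrict_apply_univ, Real.volume_Icc_pi]; simp⟩

lemma IsRandomSource.map_place (h : IsRandomSource P Q κ draw coin) (i : Input) :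
    P.map (fun ω => (draw i ω).1) = (volume : Measure (Fin d → ℝ)).restrict (Set.Icc 0 1) := by
  have := Measure.map_map measurable_fst (h.draw_measurable i) (μ := P)
  rw [h.draw_law i, Measure.map_fst_prod, measure_univ, one_smul] at this
  exact this.symm

lemma IsRandomSource.map_seed (h : IsRandomSource P Q κ draw coin) (i : Input) :
    P.map (fun ω => (draw i ω).2) = Q := by
  have := Measure.map_map measurable_snd (h.draw_measurable i) (μ := P)
  rw [h.draw_law i, Measure.map_snd_prod, measure_univ, one_smul] at this
  exact this.symm

lemma IsRandomSource.indepFun_fst_snd (h : IsRandomSource P Q κ draw coin) (i : Input) :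
    IndepFun (fun ω => (draw i ω).1) (fun ω => (draw i ω).2) P := by
  have hm := h.draw_measurable i
  rw [indepFun_iff_map_prod_eq_prod_map_map hm.fst.aemeasurable hm.snd.aemeasurable]
  rw [h.map_place, h.map_seed, ← h.draw_law i]

/-- A random input without the seeds of the samples for `𝓢_𝓘`. -/
def eraseSeed (N₀ : ℕ) (v : V) (i : Input) (p : (Fin d → ℝ) × V) : (Fin d → ℝ) × V :=
  if isI N₀ i then (p.1, v) else p

/-- The seed of a sample for `𝓢_𝓘`. -/
def seedI (N₀ : ℕ) (v : V) (i : Input) (p : (Fin d → ℝ) × V) : V :=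
  if isI N₀ i then p.2 else v

/-- Puts back the seeds of the samples for `𝓢_𝓘`. -/
def restoreSeed (N₀ : ℕ) (g : Input → (Fin d → ℝ) × V) (h : Input → V) : Input → (Fin d → ℝ) × V :=
  fun i => if isI N₀ i then ((g i).1, h i) else g i

lemma measurable_eraseSeed (N₀ : ℕ) (v : V) (i : Input) :
    Measurable (eraseSeed (d := d) N₀ v i) := by
  unfold eraseSeed
  cases isI N₀ i <;> simp <;> fun_prop

lemma measurable_seedI (N₀ : ℕ) (v : V) (i : Input) : Measurable (seedI (d := d) N₀ v i) := by
  unfold seedI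
  cases isI N₀ i <;> simp <;> fun_prop

lemma measurable_restoreSeed (N₀ : ℕ) :
    Measurable fun p : (Input → (Fin d → ℝ) × V) × (Input → V) => restoreSeed N₀ p.1 p.2 := by
  refine measurable_pi_lambda _ fun i => ?_
  unfold restoreSeed
  cases isI N₀ i <;> simp <;> fun_prop

/-- In each input the coordinates and the seed are independent, and distinct inputs are independent.
Hence the two halves of all inputs form one independent family indexed by `Input × Bool`, which is
then divided according to the flag. -/
lemma IsRandomSource.indepFun_erase_seed (h : IsRandomSource P Q κ draw coin) (N₀ : ℕ) (v : V) :
    IndepFun (fun ω i => eraseSeed N₀ v i (draw i ω)) (fun ω i => seedI N₀ v i (draw i ω)) P := by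
  -- The coordinate `0` is padding, so that both halves have the same type.
  let X : Input → Bool → Ω → (Fin d → ℝ) × V := fun i b ω =>
    if b then (0, seedI N₀ v i (draw i ω)) else eraseSeed N₀ v i (draw i ω)
  have hX : ∀ i b, Measurable (X i b) := fun i b => by
    cases b
    · exact (measurable_eraseSeed N₀ v i).comp (h.draw_measurable i)
    · exact measurable_const.prodMk ((measurable_seedI N₀ v i).comp (h.draw_measurable i))
  have h1 : iIndepFun (fun i ω => (X i · ω)) P := by
    refine h.draw_indep.comp (fun i p (b : Bool) => if b then (0, seedI N₀ v i p) else eraseSeed N₀ v i p)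
      fun i => measurable_pi_lambda _ fun b => ?_
    cases b
    · exact measurable_eraseSeed N₀ v i
    · exact measurable_const.prodMk (measurable_seedI N₀ v i)
  have h2 : ∀ i, iIndepFun (X i) P := fun i => by
    refine iIndepFun_bool ?_
    have hs := h.indepFun_fst_snd i
    by_cases hi : isI N₀ i = true
    · have e1 : X i false = (fun u => (u, v)) ∘ fun ω => (draw i ω).1 := by
        funext ω; simp [X, eraseSeed, hi]
      have e2 : X i true = (fun y => ((0 : Fin d → ℝ), y)) ∘ fun ω => (draw i ω).2 := by
        funext ω; simp [X, seedI, hi]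
      rw [e1, e2]
      exact hs.comp (by fun_prop) (by fun_prop)
    · have e2 : X i true = fun _ => (0, v) := by
        funext ω; simp [X, seedI, hi]
      rw [e2]
      exact indepFun_const_right _ _
  have h3 := iIndepFun_uncurry' hX h1 h2
  have h4 := indepFun_of_iIndepFun_of_disjoint h3 (fun p => hX p.1 p.2)
    (S := {p | p.2 = false}) (T := {p | p.2 = true})
    (Set.disjoint_left.2 fun p hp hp' => by simp_all)
  exact h4.comp (φ := fun x i => x ⟨(i, false), rfl⟩)
    (ψ := fun x i => (x ⟨(i, true), rfl⟩).2) (by fun_prop) (by fun_prop)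

end Source

/-! ### Concentration of the sample means -/

section Noise

variable {d : ℕ} {V Ω : Type*} [MeasurableSpace V] [MeasurableSpace Ω] {P : Measure Ω}
  [IsProbabilityMeasure P] {Q : Measure V} [IsProbabilityMeasure Q] {κ : ℝ}
  {draw : Input → Ω → (Fin d → ℝ) × V} {coin : List Bool → Ω → Bool × Fin d}

lemma hasSubgaussianMGF_mono {X : V → ℝ} {c c' : ℝ≥0} (h : HasSubgaussianMGF X c Q) (hc : c ≤ c') :
    HasSubgaussianMGF X c' Q where
  integrable_exp_mul := h.integrable_exp_mul
  mgf_le t := (h.mgf_le t).trans <| Real.exp_le_exp.2 <| by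
    have : (c : ℝ) ≤ c' := hc
    have := mul_le_mul_of_nonneg_right this (sq_nonneg t)
    linarith

lemma measurable_response {sim : Pt d → V → ℝ} (hsim : Measurable (Function.uncurry sim)) :
    Measurable (response Q sim) :=
  (hsim.stronglyMeasurable.integral_prod_right' (ν := Q)).measurable

/-- Hoeffding's inequality for both tails, with the names and the positions deterministic; honesty
reduces the random tree to this case. -/
lemma measure_sum_noise_ge_le (h : IsRandomSource P Q κ draw coin) {sim : Pt d → V → ℝ}
    (hsim : Measurable (Function.uncurry sim)) {c : ℝ≥0} (hc : 0 < c)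
    (hsub : ∀ x ∈ cube d, HasSubgaussianMGF (fun v => sim x v - response Q sim x) c Q)
    {l : List Input} (hl : l.Nodup) (x : Input → Pt d) (hx : ∀ i ∈ l, x i ∈ cube d) {η : ℝ}
    (hη : 0 < η) :
    P {ω | η * l.length ≤ |(l.map fun i => sim (x i) (draw i ω).2 - response Q sim (x i)).sum|} ≤
      ENNReal.ofReal (2 * Real.exp (-(η ^ 2 / (2 * c)) * l.length)) := by
  classical
  let Z : Input → Ω → ℝ := fun i ω => sim (x i) (draw i ω).2 - response Q sim (x i)
  have hsx : ∀ i, Measurable fun v => sim (x i) v - response Q sim (x i) := fun i =>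
    (hsim.comp (measurable_const.prodMk measurable_id)).sub_const _
  have hZ : iIndepFun Z P :=
    h.draw_indep.comp (fun i p => sim (x i) p.2 - response Q sim (x i)) fun i =>
      (hsx i).comp measurable_snd
  have hZ' : iIndepFun (fun i => -Z i) P :=
    hZ.comp (fun _ y => -y) fun _ => measurable_neg
  have hsg : ∀ i ∈ l.toFinset, HasSubgaussianMGF (Z i) c P := fun i hi => by
    refine HasSubgaussianMGF.of_map (X := fun v => sim (x i) v - response Q sim (x i))
      (h.draw_measurable i).snd.aemeasurable ?_
    rw [h.map_seed i]
    exact hsub (x i) (hx i (List.mem_toFinset.1 hi))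
  have hη' : 0 ≤ η * l.length := by positivity
  have hb1 := HasSubgaussianMGF.measure_sum_ge_le_of_iIndepFun hZ (c := fun _ => c) hsg hη'
  have hb2 := HasSubgaussianMGF.measure_sum_ge_le_of_iIndepFun hZ' (c := fun _ => c)
    (s := l.toFinset) (fun i hi => (hsg i hi).neg) hη'
  have hexp : -(η * (l.length : ℝ)) ^ 2 / (2 * ((∑ _i ∈ l.toFinset, c : ℝ≥0) : ℝ)) =
      -(η ^ 2 / (2 * c)) * l.length := by
    rw [Finset.sum_const, List.toFinset_card_of_nodup hl]
    push_cast
    rw [nsmul_eq_mul]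
    have hc' : (c : ℝ) ≠ 0 := by exact_mod_cast hc.ne'
    rcases eq_or_ne (l.length : ℝ) 0 with h0 | h0
    · simp [h0]
    · field_simp
  rw [hexp] at hb1 hb2
  have hsub : {ω | η * l.length ≤ |(l.map fun i => Z i ω).sum|} ⊆
      {ω | η * l.length ≤ ∑ i ∈ l.toFinset, Z i ω} ∪
      {ω | η * l.length ≤ ∑ i ∈ l.toFinset, (-Z i) ω} := by
    intro ω hω
    rw [Set.mem_ofPred_eq, ← List.sum_toFinset _ hl] at hω
    rcases le_abs.1 hω with h1 | h1
    · exact .inl h1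
    · right
      simpa using h1
  have : P.real {ω | η * l.length ≤ |(l.map fun i => Z i ω).sum|} ≤
      2 * Real.exp (-(η ^ 2 / (2 * c)) * l.length) := by
    refine (measureReal_mono hsub).trans ((measureReal_union_le _ _).trans ?_)
    linarith
  rw [← ENNReal.ofReal_toReal (measure_ne_top P _)]
  exact ENNReal.ofReal_le_ofReal this

/-- Freeze the coins, then all inputs except the seeds for `𝓢_𝓘`. By honesty the names and positions
become constants, the remaining seeds are independent, and the noise is an ordinary sub-Gaussian
sum. -/
lemma measure_noiseBad_le (h : IsRandomSource P Q κ draw coin) [Nonempty (Fin d)]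
    (M : Model d V) (hsim : Measurable (Function.uncurry M.sim)) (hsel : M.sel.IsMeasurable)
    {c : ℝ≥0} (hc : 0 < c)
    (hsub : ∀ x ∈ cube d, HasSubgaussianMGF (fun v => M.sim x v - response Q M.sim x) c Q)
    {η : ℝ} (hη : 0 < η) (N₀ : ℕ) (a : List Bool) (k : ℕ) :
    P {ω | M.NoiseBad (fun i => draw i ω) (fun b => coin b ω) N₀ (response Q M.sim) η a k} ≤
      ENNReal.ofReal (2 * Real.exp (-(η ^ 2 / (2 * c)) * (M.β * M.f (a.length - 1) + k))) := by
  -- A dummy seed, to be stored where the true one is erased.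
  obtain ⟨v⟩ : Nonempty V := by
    by_contra hV
    rw [not_nonempty_iff] at hV
    have := measure_univ (μ := Q)
    rw [Set.eq_empty_of_isEmpty (Set.univ : Set V), measure_empty] at this
    exact zero_ne_one this
  have hA := M.measurableSet_noiseBad N₀ hsim hsel (measurable_response (Q := Q) hsim) η a k
  have hdraw : Measurable fun ω i => draw i ω := measurable_pi_lambda _ h.draw_measurable
  have hcoin : Measurable fun ω b => coin b ω := measurable_pi_lambda _ h.coin_measurable
  refine measure_le_of_sections hcoin hdraw h.draw_coin_indep.symm
    (A := {p | M.NoiseBad p.2 p.1 N₀ (response Q M.sim) η a k}) (measurable_swap hA) fun e => ?_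
  have hrestore : ∀ ω, restoreSeed N₀ (fun i => eraseSeed N₀ v i (draw i ω))
      (fun i => seedI N₀ v i (draw i ω)) = fun i => draw i ω := fun ω => by
    funext i
    by_cases hi : isI N₀ i = true <;> simp [restoreSeed, eraseSeed, seedI, hi]
  have hG : Measurable fun ω i => eraseSeed N₀ v i (draw i ω) :=
    measurable_pi_lambda _ fun i => (measurable_eraseSeed N₀ v i).comp (h.draw_measurable i)
  have hH : Measurable fun ω i => seedI N₀ v i (draw i ω) :=
    measurable_pi_lambda _ fun i => (measurable_seedI N₀ v i).comp (h.draw_measurable i)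
  have key := measure_le_of_sections (P := P) hG hH (h.indepFun_erase_seed N₀ v)
    (A := {p | M.NoiseBad (restoreSeed N₀ p.1 p.2) e N₀ (response Q M.sim) η a k})
    (((measurable_restoreSeed N₀).prodMk measurable_const) hA)
    (c := ENNReal.ofReal (2 * Real.exp (-(η ^ 2 / (2 * c)) * (M.β * M.f (a.length - 1) + k)))) ?_
  · simpa only [Set.mem_ofPred_eq, hrestore] using key
  intro g
  have hg : ∀ s : Input → V, ∀ i, (restoreSeed N₀ g s i).1 = (g i).1 ∧
      (isI N₀ i = false → restoreSeed N₀ g s i = g i) := fun s i => by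
    by_cases hi : isI N₀ i = true <;> simp [restoreSeed, hi]
  have htag : ∀ s, M.leafTags (restoreSeed N₀ g s) e N₀ a k = M.leafTags g e N₀ a k := fun s => by
    rw [Model.leafTags, M.tagI_congr_seed N₀ (hg s)]
    rfl
  have hpos : ∀ s i, M.pos (restoreSeed N₀ g s) e N₀ i = M.pos g e N₀ i := fun s i =>
    M.pos_congr_seed N₀ (hg s) i
  have hI : ∀ i ∈ M.leafTags g e N₀ a k, isI N₀ i = true := fun i hi => by
    rcases List.mem_append.1 hi with hi | hi
    · rcases M.tagI_level g e N₀ a i hi with ⟨n, hn, rfl⟩ | ⟨b, n, -, rfl⟩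
      · simpa [isI] using hn
      · rfl
    · obtain ⟨n, -, rfl⟩ := List.mem_map.1 hi
      rfl
  -- The first two clauses of `NoiseBad` concern frozen data only. Either they fail and the section
  -- is empty, or they supply the sample count and the positions in the cube that Hoeffding needs.
  by_cases hgood : M.β * M.f (a.length - 1) + k ≤ (M.leafTags g e N₀ a k).length ∧
      ∀ i ∈ M.leafTags g e N₀ a k, M.pos g e N₀ i ∈ cube d
  · have hb := measure_sum_noise_ge_le h hsim hc hsub
      (M.nodup_tagI_append g e N₀ a (M.nodup_tagI g e N₀ a) k) (M.pos g e N₀) hgood.2 hη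
    refine (measure_mono fun ω hω => ?_).trans (hb.trans (ENNReal.ofReal_le_ofReal ?_))
    · obtain ⟨-, -, h3⟩ := hω
      dsimp only at h3
      rw [Model.noiseSum, htag] at h3
      refine h3.trans (le_of_eq ?_)
      congr 2
      refine List.map_congr_left fun i hi => ?_
      have h4 : (M.samp (restoreSeed N₀ g fun i => seedI N₀ v i (draw i ω)) e N₀ i).2 =
          M.sim (M.pos g e N₀ i) (draw i ω).2 := by
        rw [← hpos (fun i => seedI N₀ v i (draw i ω)) i]
        change M.sim (M.pos (restoreSeed N₀ g fun i => seedI N₀ v i (draw i ω)) e N₀ i) _ = _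
        simp [restoreSeed, seedI, hI i hi]
      rw [h4, hpos]
    · have h5 : 0 ≤ η ^ 2 / (2 * (c : ℝ)) := by positivity
      have := mul_le_mul_of_nonneg_left hgood.1 h5
      have : Real.exp (-(η ^ 2 / (2 * c)) * (M.leafTags g e N₀ a k).length) ≤
          Real.exp (-(η ^ 2 / (2 * c)) * (M.β * M.f (a.length - 1) + k)) :=
        Real.exp_le_exp.2 (by linarith)
      change 2 * Real.exp (-(η ^ 2 / (2 * c)) * (M.leafTags g e N₀ a k).length) ≤ _
      linarith
  · have : {ω | (g, fun i => seedI N₀ v i (draw i ω)) ∈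
        {p : (Input → (Fin d → ℝ) × V) × (Input → V) |
          M.NoiseBad (restoreSeed N₀ p.1 p.2) e N₀ (response Q M.sim) η a k}} = ∅ := by
      refine Set.eq_empty_of_forall_notMem fun ω hω => hgood ?_
      obtain ⟨h1, h2, -⟩ := hω
      dsimp only at h1 h2
      rw [htag] at h1 h2
      exact ⟨h1, fun i hi => hpos _ i ▸ h2 i hi⟩
    rw [this, measure_empty]
    exact zero_le

end Noise

/-! ### The random cuts on the path to a point -/

section Path

variable {d : ℕ} {V Ω : Type*} [MeasurableSpace V] [MeasurableSpace Ω] {P : Measure Ω}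
  [IsProbabilityMeasure P] {Q : Measure V} [IsProbabilityMeasure Q] {κ : ℝ}
  {draw : Input → Ω → (Fin d → ℝ) × V} {coin : List Bool → Ω → Bool × Fin d}

/-- The coin forces a cut along `j` with probability `κ/d`, giving `(κ/d)·½ + (1 - κ/d)`, the factor
gained per level of a branch. -/
lemma lintegral_coin (h : IsRandomSource P Q κ draw coin) (a : List Bool) (j : Fin d) :
    ∫⁻ ω, (if coin a ω = (true, j) then 2⁻¹ else 1) ∂P = 1 - ENNReal.ofReal (κ / d) / 2 := by
  have hms : MeasurableSet {ω | coin a ω = (true, j)} :=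
    h.coin_measurable a (measurableSet_singleton (true, j))
  have h1 : ∫⁻ ω, (if coin a ω = (true, j) then (2⁻¹ : ℝ≥0∞) else 1) ∂P +
      ENNReal.ofReal (κ / d) / 2 = 1 := by
    have h2 : ∫⁻ ω, Set.indicator {ω | coin a ω = (true, j)} (fun _ => (2⁻¹ : ℝ≥0∞)) ω ∂P =
        ENNReal.ofReal (κ / d) / 2 := by
      rw [lintegral_indicator_const hms, h.coin_law a true j, if_pos rfl, ENNReal.div_eq_inv_mul]
    rw [← h2, ← lintegral_add_right _ (measurable_const.indicator hms)]
    have : ∀ ω, (if coin a ω = (true, j) then (2⁻¹ : ℝ≥0∞) else 1) +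
        Set.indicator {ω | coin a ω = (true, j)} (fun _ => (2⁻¹ : ℝ≥0∞)) ω = 1 := fun ω => by
      by_cases hc : coin a ω = (true, j)
      · simp [hc, Set.indicator, ENNReal.inv_two_add_inv_two]
      · simp [hc, Set.indicator]
    simp [this]
  refine ENNReal.eq_sub_of_add_eq ?_ h1
  exact ENNReal.div_ne_top ENNReal.ofReal_ne_top (by norm_num)

/-- The branch down to depth `k` and its count are functions of coins at depths below `k`, while the
next factor uses the coin at the end of the branch. As that address is random, the integral is first
decomposed over its possible values, for each of which the two factors are independent. -/
lemma lintegral_cutCount_pathTo (h : IsRandomSource P Q κ draw coin) [Nonempty (Fin d)]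
    (M : Model d V) (hsim : Measurable (Function.uncurry M.sim)) (hsel : M.sel.IsMeasurable)
    (N₀ : ℕ) (w : Input → (Fin d → ℝ) × V) (x : Pt d) (j : Fin d) (k : ℕ) :
    ∫⁻ ω, (2⁻¹ : ℝ≥0∞) ^ cutCount (fun b => coin b ω) j (M.pathTo w (fun b => coin b ω) N₀ x k) ∂P =
      (1 - ENNReal.ofReal (κ / d) / 2) ^ k := by
  have hpow : Measurable fun n : ℕ => (2⁻¹ : ℝ≥0∞) ^ n := measurable_from_top
  induction k with
  | zero => simp [Model.pathTo, cutCount]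
  | succ k ih =>
    set q := 1 - ENNReal.ofReal (κ / d) / 2 with hq
    set F : (List Bool → Bool × Fin d) → ℝ≥0∞ := fun e =>
      (2⁻¹ : ℝ≥0∞) ^ cutCount e j (M.pathTo w e N₀ x k) with hF
    let G : List Bool → (List Bool → Bool × Fin d) → ℝ≥0∞ := fun a e =>
      if M.pathTo w e N₀ x k = a then F e else 0
    let D : List Bool → Bool × Fin d → ℝ≥0∞ := fun _ c => if c = (true, j) then 2⁻¹ else 1
    have hcoin : Measurable fun ω b => coin b ω := measurable_pi_lambda _ h.coin_measurable
    have hw : Measurable fun e : List Bool → Bool × Fin d => (w, e) := measurable_prodMk_left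
    have hFm : Measurable F := hpow.comp ((M.measurable_cutCount_pathTo N₀ hsim hsel x k j).comp hw)
    have hGm : ∀ a, Measurable (G a) := fun a =>
      Measurable.ite (((M.measurable_pathTo N₀ hsim hsel x k).comp hw) (measurableSet_singleton a))
        hFm measurable_const
    have hDm : ∀ a, Measurable (D a) := fun a => measurable_of_finite _
    have hGc : ∀ a, Measurable fun ω => G a fun b => coin b ω := fun a => (hGm a).comp hcoin
    have hDc : ∀ a, Measurable fun ω => D a (coin a ω) := fun a =>
      (hDm a).comp (h.coin_measurable a)
    have hsum : ∀ ω, (2⁻¹ : ℝ≥0∞) ^ cutCount (fun b => coin b ω) j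
        (M.pathTo w (fun b => coin b ω) N₀ x (k + 1)) =
        ∑' a, G a (fun b => coin b ω) * D a (coin a ω) := fun ω => by
      rw [tsum_eq_single (M.pathTo w (fun b => coin b ω) N₀ x k)]
      · simp only [Model.pathTo, cutCount, G, F, D, if_true]
        rw [pow_add, mul_comm]
        split_ifs <;> simp
      · intro a ha
        simp only [G, if_neg ha.symm, zero_mul]
    have hsum' : ∀ ω, F (fun b => coin b ω) = ∑' a, G a (fun b => coin b ω) := fun ω => by
      rw [tsum_eq_single (M.pathTo w (fun b => coin b ω) N₀ x k)]
      · simp only [G, if_true]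
      · intro a ha
        simp only [G, if_neg ha.symm]
    have hprod : ∀ a, ∫⁻ ω, G a (fun b => coin b ω) * D a (coin a ω) ∂P =
        (∫⁻ ω, G a (fun b => coin b ω) ∂P) * q := fun a => by
      by_cases ha : a.length = k
      · classical
        have hind : IndepFun (fun ω => G a (fun b => coin b ω)) (fun ω => D a (coin a ω)) P := by
          have h0 := indepFun_of_iIndepFun_of_disjoint h.coin_indep h.coin_measurable
            (S := {b | b.length < k}) (T := {a})
            (Set.disjoint_singleton_right.2 (by simp [ha]))
          -- The default value at longer addresses is never read by the branch or by its count up to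
          -- depth `k`.
          let ext : ({b : List Bool | b.length < k} → Bool × Fin d) → List Bool → Bool × Fin d :=
            fun y b => if hb : b.length < k then y ⟨b, hb⟩ else (true, j)
          have hext : Measurable ext := by
            refine measurable_pi_lambda _ fun b => ?_
            by_cases hb : b.length < k
            · simp only [ext, hb, dif_pos]
              exact measurable_pi_apply _
            · simp only [ext, hb, dif_neg, not_false_eq_true]
              exact measurable_const
          have hψ : Measurable fun y : ({a} : Set (List Bool)) → Bool × Fin d => D a (y ⟨a, rfl⟩) :=
            (hDm a).comp (measurable_pi_apply _)
          have h1 := h0.comp (φ := fun y => G a (ext y)) ((hGm a).comp hext) hψ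
          refine h1.congr (ae_of_all _ fun ω => ?_) (ae_of_all _ fun ω => rfl)
          have he : ∀ b : List Bool, b.length < k →
              ext (fun b : {b : List Bool | b.length < k} => coin b ω) b = coin b ω := fun b hb => by
            simp [ext, hb]
          have hp := M.pathTo_congr_coin (w := w) N₀ x k he
          have hcnt : cutCount (ext fun b : {b : List Bool | b.length < k} => coin b ω) j
              (M.pathTo w (fun b => coin b ω) N₀ x k) =
              cutCount (fun b => coin b ω) j (M.pathTo w (fun b => coin b ω) N₀ x k) :=
            cutCount_congr_coin j _ fun b hb => he b (by simpa using hb)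
          simp only [Function.comp_apply, G, F]
          rw [hp, hcnt]
        rw [lintegral_mul_eq_lintegral_mul_lintegral_of_indepFun''
          (hGc a).aemeasurable (hDc a).aemeasurable hind, lintegral_coin h a j]
      · have : ∀ e, G a e = 0 := fun e => if_neg fun h0 => ha (by rw [← h0]; simp)
        simp [this]
    simp only [hsum]
    rw [lintegral_tsum (f := fun a ω => G a (fun b => coin b ω) * D a (coin a ω))
      fun a => ((hGc a).mul (hDc a)).aemeasurable]
    simp only [hprod]
    rw [ENNReal.tsum_mul_right, ← lintegral_tsum fun a => (hGc a).aemeasurable, pow_succ,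
      ← ih]
    simp only [← hsum', hF]

/-- Markov's inequality for `2^(-count)`, with the draws frozen first; they are independent of the
coins. -/
lemma measure_cutCount_lt_le (h : IsRandomSource P Q κ draw coin) [Nonempty (Fin d)]
    (M : Model d V) (hsim : Measurable (Function.uncurry M.sim)) (hsel : M.sel.IsMeasurable)
    (N₀ : ℕ) (x : Pt d) (j : Fin d) (k t : ℕ) :
    P {ω | cutCount (fun b => coin b ω) j
      (M.pathTo (fun i => draw i ω) (fun b => coin b ω) N₀ x k) < t} ≤
      2 ^ t * (1 - ENNReal.ofReal (κ / d) / 2) ^ k := by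
  have hdraw : Measurable fun ω i => draw i ω := measurable_pi_lambda _ h.draw_measurable
  have hcoin : Measurable fun ω b => coin b ω := measurable_pi_lambda _ h.coin_measurable
  have hA : MeasurableSet {p : Inputs d V | cutCount p.2 j (M.pathTo p.1 p.2 N₀ x k) < t} :=
    measurableSet_lt (M.measurable_cutCount_pathTo N₀ hsim hsel x k j) measurable_const
  refine measure_le_of_sections hdraw hcoin h.draw_coin_indep hA fun w => ?_
  have hpow : Measurable fun n : ℕ => (2⁻¹ : ℝ≥0∞) ^ n := measurable_from_top
  have hm : Measurable fun ω => (2⁻¹ : ℝ≥0∞) ^ cutCount (fun b => coin b ω) j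
      (M.pathTo w (fun b => coin b ω) N₀ x k) :=
    hpow.comp ((M.measurable_cutCount_pathTo N₀ hsim hsel x k j).comp
      ((measurable_prodMk_left (x := w)).comp hcoin))
  have h1 := mul_meas_ge_le_lintegral (μ := P) hm (2⁻¹ ^ t)
  rw [lintegral_cutCount_pathTo h M hsim hsel] at h1
  have h2 : P {ω | (w, fun b => coin b ω) ∈
      {p : Inputs d V | cutCount p.2 j (M.pathTo p.1 p.2 N₀ x k) < t}} ≤
      P {ω | (2⁻¹ : ℝ≥0∞) ^ t ≤ 2⁻¹ ^ cutCount (fun b => coin b ω) j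
        (M.pathTo w (fun b => coin b ω) N₀ x k)} :=
    measure_mono fun ω hω => pow_le_pow_right_of_le_one' (ENNReal.inv_le_one.2 one_le_two) (le_of_lt hω)
  refine h2.trans ?_
  have h3 := mul_le_mul_right h1 (2 ^ t : ℝ≥0∞)
  rwa [← mul_assoc, ← mul_pow, ENNReal.mul_inv_cancel (by norm_num) (by norm_num), one_pow,
    one_mul] at h3

end Path

/-! ### Asymptotics of the depth conditions -/

section Limits

/-- The depth condition at the budgets between those at which the tree gets deeper implies that
even the threshold one level above the shallowest leaf dominates the depth. -/
lemma eventually_depth_le_threshold {f hm hp : ℕ → ℕ} {β : ℝ} {N₁ : ℕ} (hβ : 0 < β)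
    (hf : ∀ c, 0 < f c) (hmono : Monotone f)
    (hlow : ∀ N, N₁ ≤ N → ∀ c, 0 < c → c ≤ hm N → 2 ^ c * (β * f (c - 1)) ≤ (2 * N : ℝ))
    (hup : ∀ N, N₁ ≤ N → N ≤ 3 * (2 ^ hp N * f (hp N)) + 1)
    (hhm : Tendsto hm atTop atTop)
    (hratio : Tendsto (fun N => (hp N : ℝ) / (f (hm N) : ℝ)) atTop (𝓝 0)) {K : ℝ} (hK : 0 < K) :
    ∀ᶠ N in atTop, K * hm N ≤ f (hm N - 1) := by
  -- To be used at the smaller budget `N'` below: the factor `2` there makes the deepest leaf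
  -- shallower than half of `c`.
  have hev := hratio.eventually_lt_const (show (0 : ℝ) < 1 / (2 * K) by positivity)
  obtain ⟨N₂, hN₂⟩ := eventually_atTop.1 hev
  have hpow : Tendsto (fun c : ℕ => (2 : ℝ) ^ (c / 2) * β) atTop atTop :=
    ((tendsto_pow_atTop_atTop_of_one_lt one_lt_two).comp
      (Nat.tendsto_div_const_atTop two_ne_zero)).atTop_mul_const hβ
  -- The constant makes `A` exceed `11 · 2^(c/2) F`, enough to beat the upper bound `3 · 2^(c/2) F +
  -- 1` on `N'` after halving and rounding; the remaining terms keep `N'` beyond `N₁` and `N₂`.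
  have hbig := hpow.eventually_ge_atTop (11 + 2 * (N₁ + N₂ + 1))
  filter_upwards [hhm.eventually hbig, hhm.eventually_gt_atTop 0] with N hN hc0
  set c := hm N with hc
  set F := f (c - 1) with hF
  have hF1 : (1 : ℝ) ≤ F := by exact_mod_cast hf _
  set A : ℝ := 2 ^ c * (β * F) with hA
  set s : ℝ := 2 ^ (c / 2) with hs
  have hs1 : 1 ≤ s := one_le_pow₀ one_le_two
  have hsc : s * s ≤ 2 ^ c := by
    rw [hs, ← pow_add]
    exact pow_le_pow_right₀ one_le_two (by omega)
  have hA1 : (11 + 2 * (N₁ + N₂ + 1)) * s * F ≤ A := by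
    have h1 : (11 + 2 * (N₁ + N₂ + 1)) * s ≤ 2 ^ c * β := by nlinarith
    have := mul_le_mul_of_nonneg_right h1 (by linarith : (0 : ℝ) ≤ F)
    linarith
  have hsF : 1 ≤ s * F := by nlinarith
  have hA2 : 11 + 2 * (N₁ + N₂ + 1) ≤ A := by
    have h0 : (0 : ℝ) ≤ 11 + 2 * (N₁ + N₂ + 1) := by positivity
    have := mul_le_mul_of_nonneg_left hsF h0
    linarith
  by_contra! hcon
  -- The largest budget below `A / 2`. Minimal depth `c` would require `A ≤ 2 N'`, so `hm N' < c`
  -- and the threshold in the ratio at `N'` is at most `F`.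
  set N' := ⌈A / 2⌉₊ - 1 with hN'
  have hceil : 0 < ⌈A / 2⌉₊ := Nat.ceil_pos.2 (by
    have : (0 : ℝ) ≤ N₁ + N₂ + 1 := by positivity
    linarith)
  have hcast : ((⌈A / 2⌉₊ : ℕ) : ℝ) = N' + 1 := by
    have : ⌈A / 2⌉₊ = N' + 1 := by omega
    rw [this]; push_cast; ring
  have h1 : (N' : ℝ) < A / 2 := by
    have := Nat.ceil_lt_add_one (show 0 ≤ A / 2 by
      have : (0 : ℝ) ≤ N₁ + N₂ + 1 := by positivity
      linarith)
    linarith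
  have h2 : A / 2 ≤ N' + 1 := by
    have := Nat.le_ceil (A / 2)
    linarith
  have h3 : (N₁ + N₂ : ℝ) ≤ N' := by linarith
  have h3' : N₁ + N₂ ≤ N' := by exact_mod_cast h3
  have h4 : hm N' < c := by
    by_contra! h
    have := hlow N' (by omega) c hc0 h
    linarith
  have h5 : (f (hm N') : ℝ) ≤ F := by exact_mod_cast hmono (by omega : hm N' ≤ c - 1)
  have h6 := hN₂ N' (by omega)
  have hfpos : (0 : ℝ) < f (hm N') := by exact_mod_cast hf _
  rw [div_lt_iff₀ hfpos, one_div, inv_mul_eq_div, lt_div_iff₀ (by positivity)] at h6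
  -- The ratio bound gives `2 K hp(N') < f(hm N') ≤ F`, and `F < K c` by contradiction hypothesis. A
  -- tree of depth below `c / 2` then uses at most about `3 · 2^(c/2) F` simulations, far fewer than
  -- `N'`.
  have h7 : 2 * hp N' < c := by
    have : K * (2 * hp N') < K * c := by nlinarith
    have := lt_of_mul_lt_mul_left this hK.le
    exact_mod_cast this
  have h8 : f (hp N') ≤ F := hmono (by omega)
  have h9 : 2 ^ hp N' ≤ 2 ^ (c / 2) := Nat.pow_le_pow_right two_pos (by omega)
  have h10 : N' ≤ 3 * (2 ^ (c / 2) * F) + 1 :=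
    (hup N' (by omega)).trans (by have := Nat.mul_le_mul h9 h8; omega)
  have h11 : (N' : ℝ) ≤ 3 * (s * F) + 1 := by
    rw [hs]
    exact_mod_cast h10
  have h12 : (0 : ℝ) ≤ N₁ + N₂ + 1 := by positivity
  nlinarith

/-- The union bound over the leaves is negligible. -/
lemma tendsto_union_bound {f hm hp : ℕ → ℕ} {θ : ℝ} (hθ : 0 < θ) (hf : ∀ c, 0 < f c)
    (hle : ∀ᶠ N in atTop, hm N ≤ hp N) (hhm : Tendsto hm atTop atTop)
    (hratio : Tendsto (fun N => (hp N : ℝ) / (f (hm N) : ℝ)) atTop (𝓝 0))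
    (hthr : ∀ K : ℝ, 0 < K → ∀ᶠ N in atTop, K * hm N ≤ f (hm N - 1)) :
    Tendsto (fun N => 2 ^ hm N * Real.exp (-θ * f (hm N - 1)) +
      2 ^ (hp N + 1) * Real.exp (-θ * f (hm N))) atTop (𝓝 0) := by
  have htwo : ∀ n : ℕ, (2 : ℝ) ^ n ≤ Real.exp n := fun n => by
    have h2 : (2 : ℝ) ≤ Real.exp 1 := by
      have := Real.add_one_le_exp 1
      linarith
    calc (2 : ℝ) ^ n ≤ Real.exp 1 ^ n := pow_le_pow_left₀ zero_le_two h2 n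
      _ = Real.exp n := by rw [← Real.exp_nat_mul, mul_one]
  have hlim : Tendsto (fun N => 3 * Real.exp (-(hm N : ℝ))) atTop (𝓝 0) := by
    have h1 : Tendsto (fun N => (hm N : ℝ)) atTop atTop := tendsto_natCast_atTop_atTop.comp hhm
    simpa using (Real.tendsto_exp_neg_atTop_nhds_zero.comp h1).const_mul 3
  refine squeeze_zero' (Eventually.of_forall fun N => by positivity) ?_ hlim
  have hev := hratio.eventually_lt_const (show (0 : ℝ) < θ / 2 by positivity)
  -- With `K = 2 / θ` and the ratio below `θ / 2`, each exponent is at least twice the depth it must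
  -- beat: half absorbs the power of two, half gives the decay.
  filter_upwards [hle, hev, hthr (2 / θ) (by positivity)] with N h1 h2 h3
  have hfpos : (0 : ℝ) < f (hm N) := by exact_mod_cast hf _
  rw [div_lt_iff₀ hfpos] at h2
  rw [div_mul_eq_mul_div, div_le_iff₀ hθ] at h3
  have h1' : (hm N : ℝ) ≤ hp N := by exact_mod_cast h1
  have e1 : 2 ^ hm N * Real.exp (-θ * f (hm N - 1)) ≤ Real.exp (-(hm N : ℝ)) := by
    refine (mul_le_mul_of_nonneg_right (htwo _) (Real.exp_pos _).le).trans ?_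
    rw [← Real.exp_add]
    exact Real.exp_le_exp.2 (by linarith)
  have e2 : 2 ^ (hp N + 1) * Real.exp (-θ * f (hm N)) ≤ 2 * Real.exp (-(hm N : ℝ)) := by
    rw [pow_succ, mul_comm _ (2 : ℝ), mul_assoc]
    refine mul_le_mul_of_nonneg_left ?_ zero_le_two
    refine (mul_le_mul_of_nonneg_right (htwo _) (Real.exp_pos _).le).trans ?_
    rw [← Real.exp_add]
    exact Real.exp_le_exp.2 (by linarith)
  linarith

/-- On every level except the lowest, `m ≤ c - 1`, so the threshold is at least `f(m)` and the
powers of two sum geometrically. The lowest level has to be kept apart with `f(m - 1)`. -/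
lemma sum_Icc_two_pow_mul_exp_le {f : ℕ → ℕ} (hmono : Monotone f) {θ : ℝ} (hθ : 0 < θ) {m p : ℕ}
    (hmp : m ≤ p) :
    ∑ c ∈ Finset.Icc m p, (2 : ℝ) ^ c * Real.exp (-θ * f (c - 1)) ≤
      2 ^ m * Real.exp (-θ * f (m - 1)) + 2 ^ (p + 1) * Real.exp (-θ * f m) := by
  rw [← Finset.sum_erase_add _ _ (Finset.left_mem_Icc.2 hmp), add_comm]
  refine add_le_add le_rfl ?_
  calc ∑ c ∈ (Finset.Icc m p).erase m, (2 : ℝ) ^ c * Real.exp (-θ * f (c - 1))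
      ≤ ∑ c ∈ (Finset.Icc m p).erase m, (2 : ℝ) ^ c * Real.exp (-θ * f m) := by
        refine Finset.sum_le_sum fun c hc => ?_
        rw [Finset.mem_erase, Finset.mem_Icc] at hc
        have h1 : (f m : ℝ) ≤ f (c - 1) := by exact_mod_cast hmono (by omega : m ≤ c - 1)
        have h2 := mul_le_mul_of_nonneg_left h1 hθ.le
        exact mul_le_mul_of_nonneg_left (Real.exp_le_exp.2 (by linarith)) (by positivity)
    _ = (∑ c ∈ (Finset.Icc m p).erase m, (2 : ℝ) ^ c) * Real.exp (-θ * f m) := by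
        rw [Finset.sum_mul]
    _ ≤ 2 ^ (p + 1) * Real.exp (-θ * f m) := by
        refine mul_le_mul_of_nonneg_right ?_ (Real.exp_pos _).le
        calc ∑ c ∈ (Finset.Icc m p).erase m, (2 : ℝ) ^ c
            ≤ ∑ c ∈ Finset.range (p + 1), (2 : ℝ) ^ c := by
              refine Finset.sum_le_sum_of_subset_of_nonneg (fun c hc => ?_)
                fun _ _ _ => by positivity
              rw [Finset.mem_erase, Finset.mem_Icc] at hc
              rw [Finset.mem_range]
              omega
          _ ≤ 2 ^ (p + 1) := by
              rw [geom_sum_eq (by norm_num)]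
              norm_num

end Limits

/-! ### Union bound over addresses and visit counts -/

section Events

variable {d : ℕ} {V Ω : Type*} [MeasurableSpace V] [MeasurableSpace Ω] {P : Measure Ω}
  [IsProbabilityMeasure P] {Q : Measure V} [IsProbabilityMeasure Q] {κ : ℝ}
  {draw : Input → Ω → (Fin d → ℝ) × V} {coin : List Bool → Ω → Bool × Fin d}

lemma IsRandomSource.ae_pos_le_one (h : IsRandomSource P Q κ draw coin) :
    ∀ᵐ ω ∂P, ∀ i j, 0 < (draw i ω).1 j ∧ (draw i ω).1 j ≤ 1 := by
  rw [ae_all_iff]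
  intro i
  have hm := h.draw_measurable i
  have h2 : ∀ᵐ u ∂(P.map fun ω => (draw i ω).1), ∀ j, 0 < u j ∧ u j ≤ 1 := by
    rw [h.map_place]
    have h3 : ∀ᵐ u ∂((volume : Measure (Fin d → ℝ)).restrict (Set.Icc 0 1)), ∀ j, u j ≠ 0 := by
      refine ae_restrict_of_ae (ae_all_iff.2 fun j => ?_)
      rw [ae_iff, volume_pi]
      simpa using Measure.pi_hyperplane (fun _ : Fin d => (volume : Measure ℝ)) j 0
    filter_upwards [h3, ae_restrict_mem measurableSet_Icc] with u hu hu' j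
    exact ⟨lt_of_le_of_ne (hu'.1 j) (hu j).symm, hu'.2 j⟩
  exact ae_of_ae_map hm.fst.aemeasurable h2

/-- The union runs over every address in the depth range, reached or not, and every visit count, so
no strategy enters. The `k` in the sample count of `NoiseBad` makes the union over visits a
convergent geometric series. -/
lemma measure_exists_noiseBad_le (h : IsRandomSource P Q κ draw coin) [Nonempty (Fin d)]
    (M : Model d V) (hsim : Measurable (Function.uncurry M.sim)) (hsel : M.sel.IsMeasurable)
    {c : ℝ≥0} (hc : 0 < c)
    (hsub : ∀ x ∈ cube d, HasSubgaussianMGF (fun v => M.sim x v - response Q M.sim x) c Q)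
    (hmono : Monotone M.f) (hβ : 0 < M.β) {η : ℝ} (hη : 0 < η) (N₀ : ℕ) {m p : ℕ} (hmp : m ≤ p) :
    P {ω | ∃ a : List Bool, (m ≤ a.length ∧ a.length ≤ p) ∧ ∃ k,
      M.NoiseBad (fun i => draw i ω) (fun b => coin b ω) N₀ (response Q M.sim) η a k} ≤
      (∑' k : ℕ, ENNReal.ofReal (2 * Real.exp (-(η ^ 2 / (2 * c)) * k))) *
      ENNReal.ofReal (2 ^ m * Real.exp (-(η ^ 2 / (2 * c) * M.β) * M.f (m - 1)) +
        2 ^ (p + 1) * Real.exp (-(η ^ 2 / (2 * c) * M.β) * M.f m)) := by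
  set θ := η ^ 2 / (2 * (c : ℝ)) with hθ
  have hθ0 : 0 < θ := by positivity
  set T := ∑' k : ℕ, ENNReal.ofReal (2 * Real.exp (-θ * k)) with hT
  let B : List Bool → ℕ → Set Ω := fun a k =>
    {ω | M.NoiseBad (fun i => draw i ω) (fun b => coin b ω) N₀ (response Q M.sim) η a k}
  have hB : ∀ a, P (⋃ k, B a k) ≤ ENNReal.ofReal (Real.exp (-(θ * M.β) * M.f (a.length - 1))) * T := by
    intro a
    refine (measure_iUnion_le _).trans ?_
    rw [hT, ← ENNReal.tsum_mul_left]
    refine ENNReal.tsum_le_tsum fun k => ?_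
    refine (measure_noiseBad_le h M hsim hsel hc hsub hη N₀ a k).trans (le_of_eq ?_)
    rw [← ENNReal.ofReal_mul (Real.exp_pos _).le, mul_left_comm, ← Real.exp_add]
    congr 3
    ring
  have hsubset : {ω | ∃ a : List Bool, (m ≤ a.length ∧ a.length ≤ p) ∧ ∃ k,
      M.NoiseBad (fun i => draw i ω) (fun b => coin b ω) N₀ (response Q M.sim) η a k} ⊆
      ⋃ l ∈ Finset.Icc m p, ⋃ v : Fin l → Bool, ⋃ k, B (List.ofFn v) k := by
    rintro ω ⟨a, ha, k, hk⟩
    refine Set.mem_iUnion₂.2 ⟨a.length, Finset.mem_Icc.2 ha, Set.mem_iUnion.2 ⟨a.get, ?_⟩⟩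
    rw [List.ofFn_get]
    exact Set.mem_iUnion.2 ⟨k, hk⟩
  refine (measure_mono hsubset).trans ((measure_biUnion_finset_le _ _).trans ?_)
  have hlevel : ∀ l, P (⋃ v : Fin l → Bool, ⋃ k, B (List.ofFn v) k) ≤
      ENNReal.ofReal (2 ^ l * Real.exp (-(θ * M.β) * M.f (l - 1))) * T := by
    intro l
    refine (measure_iUnion_fintype_le _ _).trans ?_
    calc ∑ v : Fin l → Bool, P (⋃ k, B (List.ofFn v) k)
        ≤ ∑ _v : Fin l → Bool, ENNReal.ofReal (Real.exp (-(θ * M.β) * M.f (l - 1))) * T :=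
          Finset.sum_le_sum fun v _ => by simpa using hB (List.ofFn v)
      _ = _ := by
          rw [Finset.sum_const, Finset.card_univ, Fintype.card_fun, Fintype.card_bool,
            Fintype.card_fin, nsmul_eq_mul, ENNReal.ofReal_mul (by positivity), mul_assoc]
          congr 1
          rw [ENNReal.ofReal_pow zero_le_two]
          simp
  refine (Finset.sum_le_sum fun l _ => hlevel l).trans ?_
  rw [← Finset.sum_mul, mul_comm, ← ENNReal.ofReal_sum_of_nonneg fun l _ => by positivity]
  gcongr
  exact sum_Icc_two_pow_mul_exp_le hmono (mul_pos hθ0 hβ) hmp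

end Events

end RegularTreeSearch

end

/-! ### Assembly of the theorem -/

open RegularTreeSearch in
theorem theorem1 {d : ℕ} (hd : 0 < d)
    -- simulation model
    {V : Type*} [MeasurableSpace V] (Q : Measure V) [IsProbabilityMeasure Q]
    (sim : Pt d → V → ℝ) (hsim : Measurable (Function.uncurry sim))
    -- sub-Gaussian noise
    (Csg : ℝ≥0)
    (hsub : ∀ x ∈ cube d, HasSubgaussianMGF (fun v => sim x v - response Q sim x) (Csg ^ 2) Q)
    -- unique maximizer and one-sided Lipschitz gap bound
    (xs : Pt d) (hxs : xs ∈ cube d)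
    (hmax : ∀ x ∈ cube d, x ≠ xs → response Q sim x < response Q sim xs)
    (C : ℝ) (hC : 0 < C)
    (hlip : ∀ x ∈ cube d, response Q sim xs - response Q sim x ≤ C * ‖x - xs‖)
    -- separation gap
    (hgap : ∀ ε > 0, ∃ δ > 0, ∀ x ∈ cube d, ε ≤ ‖x - xs‖ →
      response Q sim x < response Q sim xs - δ)
    -- parameters of the algorithm
    (α κ β : ℝ) (hα : 0 < α) (hα' : α ≤ 1 / 2) (hκ : 0 < κ) (hκ' : κ ≤ 1)
    (hβ : 0 < β) (hβ' : β < 1 / 2)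
    (f : ℕ → ℕ) (hf : ∀ c, 0 < f c) (hfmono : Monotone f)
    (sel : Selector d) (hsel : sel.Optimal α β) (hselm : sel.IsMeasurable)
    (N₀ : ℕ → ℕ) (hN₀ : ∀ N, 0 < N → N₀ N < N)
    -- randomness and the tree search strategy, an arbitrary (also randomized) selection rule
    {Ω : Type*} [MeasurableSpace Ω] (P : Measure Ω) [IsProbabilityMeasure P]
    (draw : Input → Ω → (Fin d → ℝ) × V) (coin : List Bool → Ω → Bool × Fin d)
    (hsrc : IsRandomSource P Q κ draw coin)
    (strat : ℕ → Ω → Strategy d)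
    -- the final state of the run with budget `N`
    (S : ℕ → Ω → State d)
    (hS : ∀ N ω, S N ω = (Model.mk α β f sim sel).run (fun i => draw i ω) (fun a => coin a ω)
      (strat N ω) (N₀ N) N)
    -- the algorithm can be carried out with positive probability
    (hvalid : ∀ᶠ N in atTop, P {ω | (S N ω).Valid} ≠ 0)
    -- conditions on the depths of the leaves
    (hm hp : ℕ → ℕ)
    (hdepth : ∀ N, ∀ᵐ ω ∂P, (S N ω).Valid →
      ∀ L ∈ (S N ω).leaves, hm N ≤ L.depth ∧ L.depth ≤ hp N)
    (hhm : Tendsto hm atTop atTop)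
    (hratio : Tendsto (fun N => (hp N : ℝ) / (f (hm N) : ℝ)) atTop (𝓝 0))
    -- the returned leaf
    (Lstar : ℕ → Ω → Node d) (hLstar : ∀ N ω, (S N ω).IsBest (Lstar N ω)) :
    ∀ ε > 0, Tendsto
      (fun N => P {ω | (S N ω).Valid ∧ ε ≤ Metric.infDist xs (Lstar N ω).cell.region})
      atTop (𝓝 0) := by
  intro ε hε
  have : Nonempty (Fin d) := ⟨⟨0, hd⟩⟩
  obtain ⟨δ, hδ, hδgap⟩ := hgap ε hε
  set M : Model d V := Model.mk α β f sim sel with hM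
  have hsound : ∀ N ω, M.Sound (fun i => draw i ω) (fun a => coin a ω) (N₀ N) (S N ω) :=
    fun N ω => by
      rw [hS]
      exact M.run_sound _ _ _ hβ hf hfmono _ _
  -- The depth bounds hold almost surely on an event of positive probability, so some run realizes
  -- both. One such run per budget is enough to derive deterministic inequalities between `N`, `hm
  -- N` and `hp N`.
  have hwitness : ∀ᶠ N in atTop, 0 < N ∧ ∃ ω, (S N ω).Valid ∧
      ∀ L ∈ (S N ω).leaves, hm N ≤ L.depth ∧ L.depth ≤ hp N := by
    filter_upwards [hvalid, eventually_gt_atTop 0] with N hN hN0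
    refine ⟨hN0, ?_⟩
    by_contra! hcon
    refine hN ?_
    refine measure_mono_null (fun ω hω => ?_) (hdepth N)
    obtain ⟨L, hL, hL'⟩ := hcon ω hω
    exact fun h => (hL' (h hω L hL).1).not_ge (h hω L hL).2
  obtain ⟨N₁, hN₁⟩ := eventually_atTop.1 hwitness
  have hle : ∀ N, N₁ ≤ N → hm N ≤ hp N := fun N hN => by
    obtain ⟨-, ω, hv, hdep⟩ := hN₁ N hN
    obtain ⟨L, hL⟩ := List.exists_mem_of_ne_nil _ (hsound N ω).isTree.ne_nil
    exact (hdep L hL).1.trans (hdep L hL).2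
  have hthr : ∀ K : ℝ, 0 < K → ∀ᶠ N in atTop, K * hm N ≤ f (hm N - 1) := fun K hK => by
    refine eventually_depth_le_threshold (N₁ := N₁) hβ hf hfmono (fun N hN c hc hcm => ?_)
      (fun N hN => ?_) hhm hratio hK
    · obtain ⟨hN0, ω, hv, hdep⟩ := hN₁ N hN
      have h1 := M.le_sizeI _ _ _ hβ hfmono (hsound N ω) hv hc
        fun L hL => hcm.trans (hdep L hL).1
      have h2 : (S N ω).sizeI ≤ N₀ N + N := by
        rw [hS]
        exact M.run_sizeI_le _ _ _ hβ hf hfmono _ _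
      have h3 : (S N ω).sizeI ≤ 2 * N := by
        have := hN₀ N hN0
        omega
      exact h1.trans (by exact_mod_cast h3)
    · obtain ⟨-, ω, hv, hdep⟩ := hN₁ N hN
      have h1 := M.n_le _ _ _ hfmono (hsound N ω) hv fun L hL => (hdep L hL).2
      have h2 : N ≤ (S N ω).n := by
        rw [hS]
        exact M.le_run_n _ _ _ hβ hf hfmono _ _
      exact h2.trans h1
  -- The added `1` keeps the variance proxy positive when `Csg = 0`, since it appears in a
  -- denominator.
  set c : ℝ≥0 := Csg ^ 2 + 1 with hc
  have hc0 : 0 < c := by positivity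
  have hsub' : ∀ x ∈ cube d, HasSubgaussianMGF (fun v => sim x v - response Q sim x) c Q :=
    fun x hx => hasSubgaussianMGF_mono (hsub x hx) le_self_add
  set θ : ℝ := (δ / 4) ^ 2 / (2 * c) with hθ
  have hθ0 : 0 < θ := by positivity
  have hT : ∑' k : ℕ, ENNReal.ofReal (2 * Real.exp (-θ * k)) ≠ ∞ := by
    refine Summable.tsum_ofReal_ne_top (Summable.mul_left 2 ?_)
    have := Real.summable_exp_nat_mul_iff.2 (neg_neg_of_pos hθ0)
    simpa [mul_comm] using this
  -- The number of forced cuts per coordinate after which the response drops by at most `δ/4` on the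
  -- leaf of the maximizer.
  obtain ⟨t, ht⟩ : ∃ t : ℕ, C * (d * (1 - α) ^ t) ≤ δ / 4 := by
    have h1 : Tendsto (fun t : ℕ => C * (d * (1 - α) ^ t)) atTop (𝓝 (C * (d * 0))) :=
      ((tendsto_pow_atTop_nhds_zero_of_lt_one (by linarith) (by linarith)).const_mul _).const_mul _
    have h2 := h1.eventually_lt_const (u := δ / 4) (by simpa using hδ)
    obtain ⟨t, ht⟩ := h2.exists
    exact ⟨t, ht.le⟩
  set q : ℝ≥0∞ := 1 - ENNReal.ofReal (κ / d) / 2 with hq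
  have hq1 : q < 1 := by
    refine ENNReal.sub_lt_self (by simp) (by simp) ?_
    have : 0 < κ / d := div_pos hκ (by exact_mod_cast hd)
    simpa using this
  have hlim1 := tendsto_union_bound (mul_pos hθ0 hβ) hf
    (eventually_atTop.2 ⟨N₁, hle⟩) hhm hratio hthr
  have hlim : Tendsto (fun N => (∑' k : ℕ, ENNReal.ofReal (2 * Real.exp (-θ * k))) *
      ENNReal.ofReal (2 ^ hm N * Real.exp (-(θ * β) * f (hm N - 1)) +
        2 ^ (hp N + 1) * Real.exp (-(θ * β) * f (hm N))) +
      d * (2 ^ t * q ^ hm N)) atTop (𝓝 0) := by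
    have h1 := ENNReal.Tendsto.const_mul (ENNReal.tendsto_ofReal hlim1) (.inr hT)
    have h2 : Tendsto (fun N => q ^ hm N) atTop (𝓝 0) :=
      (ENNReal.tendsto_pow_atTop_nhds_zero_of_lt_one hq1).comp hhm
    have h3 := ENNReal.Tendsto.const_mul (ENNReal.Tendsto.const_mul (a := 2 ^ t) h2
      (.inr (by finiteness))) (.inr (ENNReal.natCast_ne_top d))
    simpa using h1.add h3
  refine tendsto_of_tendsto_of_tendsto_of_le_of_le' tendsto_const_nhds hlim
    (Eventually.of_forall fun _ => zero_le) ?_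
  filter_upwards [hhm.eventually_gt_atTop 0, eventually_ge_atTop N₁] with N hm0 hN
  let E₁ : Set Ω := {ω | ∃ a : List Bool, (hm N ≤ a.length ∧ a.length ≤ hp N) ∧ ∃ k,
    M.NoiseBad (fun i => draw i ω) (fun b => coin b ω) (N₀ N) (response Q sim) (δ / 4) a k}
  let E₂ : Fin d → Set Ω := fun j => {ω | cutCount (fun b => coin b ω) j
    (M.pathTo (fun i => draw i ω) (fun b => coin b ω) (N₀ N) xs (hm N)) < t}
  -- The strategy is arbitrary, so the left-hand event need not be measurable; it only has to be
  -- covered, up to a null set, by events that do not mention the strategy.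
  have hcover : ({ω | (S N ω).Valid ∧ ε ≤ Metric.infDist xs (Lstar N ω).cell.region} : Set Ω) ≤ᵐ[P]
      (E₁ ∪ ⋃ j, E₂ j : Set Ω) := by
    filter_upwards [hdepth N, hsrc.ae_pos_le_one] with ω hdep hu
    rintro ⟨hv, hdist⟩
    by_contra hcon
    have hE₁ : ω ∉ E₁ := fun h => hcon (.inl h)
    have hE₂ : ∀ j, ω ∉ E₂ j := fun j h => hcon (.inr (Set.mem_iUnion.2 ⟨j, h⟩))
    refine hdist.not_gt (M.infDist_lt_of_not_bad _ _ _ hα hα' hβ hf hu hxs hC hδ hlip hδgap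
      (hsound N ω) hv hm0 (fun L hL => (hdep hv L hL).1)
      (fun L hL k hk => hE₁ ⟨L.addr, hdep hv L hL, k, hk⟩) (fun j => not_lt.1 (hE₂ j)) ht
      (hLstar N ω))
  refine (measure_mono_ae hcover).trans ((measure_union_le _ _).trans (add_le_add ?_ ?_))
  · exact measure_exists_noiseBad_le hsrc M hsim hselm hc0 hsub' hfmono hβ (by positivity) (N₀ N)
      (hle N hN)
  · refine (measure_iUnion_fintype_le _ _).trans ?_
    refine (Finset.sum_le_sum fun j _ =>
      measure_cutCount_lt_le hsrc M hsim hselm (N₀ N) xs j (hm N) t).trans ?_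
    simp [hq]
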